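/- Let $p$ be a prime, $\Lambda=GL_3(\mathbb Z)$ and $G_p=GL_3(\mathbb Z[1/p])$. Let $L_{\mathbb Q}(\Lambda,G_p)$ be the Hecke ring: the finite $\mathbb Q$-linear combinations of double cosets $\Lambda g\Lambda$ with $g\in G_p$, each double coset being identified with the formal sum $\sum_j(\Lambda g_j)$ of the finitely many cosets $\Lambda g_j$ into which it decomposes. For integers $\delta_1,\delta_2,\delta_3$ let $t(p^{\delta_1},p^{\delta_2},p^{\delta_3})$ denote the double coset of $\mathrm{diag}(p^{\delta_1},p^{\delta_2},p^{\delta_3})$. The spherical map $\omega$ is the $\mathbb Q$-linear map to $\mathbb Q[x_1^{\pm1},x_2^{\pm1},x_3^{\pm1}]$ given by $\omega\big(\sum_j a_j(\Lambda g_j)\big)=\sum_j a_j\,\omega((\Lambda g_j))$, where $$\omega((\Lambda g))=\prod_{i=1}^{3}(x_ip^{-i})^{\delta_i}$$ if $g$ is an upper triangular representative of the coset $\Lambda g$ with diagonal entries $p^{\delta_1},p^{\delta_2},p^{\delta_3}$ (such a representative exists and the $\delta_i$ are uniquely determined by the coset). For integers $i\ge j\ge k\ge 0$ let $\mathrm{sym}_{i,j,k}$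 be the sum of all distinct monomials obtained from $x_1^ix_2^jx_3^k$ by permuting the variables. Then the images $\omega(t(1,p^a,p^b))$, $0\le a\le b\le 6$, are the following: 1) $\omega(t(1,1,1))=1$; 2) $\omega(t(1,1,p))=\frac{\mathrm{sym}_{1,0,0}}{p}$; 3) $\omega(t(1,p,p))=\frac{\mathrm{sym}_{1,1,0}}{p^{3}}$; 4) $\omega(t(1,1,p^{2}))=\frac{(p-1)\,\mathrm{sym}_{1,1,0}}{p^{3}}+\frac{\mathrm{sym}_{2,0,0}}{p^{2}}$; 5) $\omega(t(1,p,p^{2}))=\frac{(2p^2-p-1)\,\mathrm{sym}_{1,1,1}}{p^{6}}+\frac{\mathrm{sym}_{2,1,0}}{p^{4}}$; 6) $\omega(t(1,p^{2},p^{2}))=\frac{(p-1)\,\mathrm{sym}_{2,1,1}}{p^{7}}+\frac{\mathrm{sym}_{2,2,0}}{p^{6}}$; 7) $\omega(t(1,1,p^{3}))=\frac{(p^2-2p+1)\,\mathrm{sym}_{1,1,1}}{p^{5}}+\frac{(p^2-p)\,\mathrm{sym}_{2,1,0}}{p^{5}}+\frac{\mathrm{sym}_{3,0,0}}{p^{3}}$;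 8) $\omega(t(1,p,p^{3}))=\frac{(2p-2)\,\mathrm{sym}_{2,1,1}}{p^{6}}+\frac{(p-1)\,\mathrm{sym}_{2,2,0}}{p^{6}}+\frac{\mathrm{sym}_{3,1,0}}{p^{5}}$; 9) $\omega(t(1,p^{2},p^{3}))=\frac{(2p-2)\,\mathrm{sym}_{2,2,1}}{p^{8}}+\frac{(p-1)\,\mathrm{sym}_{3,1,1}}{p^{8}}+\frac{\mathrm{sym}_{3,2,0}}{p^{7}}$; 10) $\omega(t(1,p^{3},p^{3}))=\frac{(p^2-2p+1)\,\mathrm{sym}_{2,2,2}}{p^{11}}+\frac{(p^2-p)\,\mathrm{sym}_{3,2,1}}{p^{11}}+\frac{\mathrm{sym}_{3,3,0}}{p^{9}}$; 11) $\omega(t(1,1,p^{4}))=\frac{(p^2-2p+1)\,\mathrm{sym}_{2,1,1}}{p^{6}}+\frac{(p^2-p)\,\mathrm{sym}_{2,2,0}}{p^{6}}+\frac{(p^2-p)\,\mathrm{sym}_{3,1,0}}{p^{6}}+\frac{\mathrm{sym}_{4,0,0}}{p^{4}}$; 12) $\omega(t(1,p,p^{4}))=\frac{(2p^2-3p+1)\,\mathrm{sym}_{2,2,1}}{p^{8}}+\frac{(2p^2-2p)\,\mathrm{sym}_{3,1,1}}{p^{8}}+\frac{(p^2-p)\,\mathrm{sym}_{3,2,0}}{p^{8}}+\frac{\mathrm{sym}_{4,1,0}}{p^{6}}$;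 13) $\omega(t(1,p^{2},p^{4}))=\frac{(3p^3-4p^2+2p-1)\,\mathrm{sym}_{2,2,2}}{p^{11}}+\frac{(2p^3-3p^2+p)\,\mathrm{sym}_{3,2,1}}{p^{11}}+\frac{(p^3-p^2)\,\mathrm{sym}_{3,3,0}}{p^{11}}+\frac{(p^3-p^2)\,\mathrm{sym}_{4,1,1}}{p^{11}}+\frac{\mathrm{sym}_{4,2,0}}{p^{8}}$; 14) $\omega(t(1,p^{3},p^{4}))=\frac{(2p^2-3p+1)\,\mathrm{sym}_{3,2,2}}{p^{12}}+\frac{(2p^2-2p)\,\mathrm{sym}_{3,3,1}}{p^{12}}+\frac{(p^2-p)\,\mathrm{sym}_{4,2,1}}{p^{12}}+\frac{\mathrm{sym}_{4,3,0}}{p^{10}}$; 15) $\omega(t(1,p^{4},p^{4}))=\frac{(p^2-2p+1)\,\mathrm{sym}_{3,3,2}}{p^{14}}+\frac{(p^2-p)\,\mathrm{sym}_{4,2,2}}{p^{14}}+\frac{(p^2-p)\,\mathrm{sym}_{4,3,1}}{p^{14}}+\frac{\mathrm{sym}_{4,4,0}}{p^{12}}$; 16) $\omega(t(1,1,p^{5}))=\frac{(p^2-2p+1)\,\mathrm{sym}_{2,2,1}}{p^{7}}+\frac{(p^2-2p+1)\,\mathrm{sym}_{3,1,1}}{p^{7}}+\frac{(p^2-p)\,\mathrm{sym}_{3,2,0}}{p^{7}}+\frac{(p^2-p)\,\mathrm{sym}_{4,1,0}}{p^{7}}+\frac{\mathrm{sym}_{5,0,0}}{p^{5}}$;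 17) $\omega(t(1,p,p^{5}))=\frac{(2p^2-4p+2)\,\mathrm{sym}_{2,2,2}}{p^{9}}+\frac{(2p^2-3p+1)\,\mathrm{sym}_{3,2,1}}{p^{9}}+\frac{(p^2-p)\,\mathrm{sym}_{3,3,0}}{p^{9}}+\frac{(2p^2-2p)\,\mathrm{sym}_{4,1,1}}{p^{9}}+\frac{(p^2-p)\,\mathrm{sym}_{4,2,0}}{p^{9}}+\frac{\mathrm{sym}_{5,1,0}}{p^{7}}$; 18) $\omega(t(1,p^{2},p^{5}))=\frac{(3p^3-5p^2+3p-1)\,\mathrm{sym}_{3,2,2}}{p^{12}}+\frac{(2p^3-4p^2+2p)\,\mathrm{sym}_{3,3,1}}{p^{12}}+\frac{(2p^3-3p^2+p)\,\mathrm{sym}_{4,2,1}}{p^{12}}+\frac{(p^3-p^2)\,\mathrm{sym}_{4,3,0}}{p^{12}}+\frac{(p^3-p^2)\,\mathrm{sym}_{5,1,1}}{p^{12}}+\frac{\mathrm{sym}_{5,2,0}}{p^{9}}$; 19) $\omega(t(1,p^{3},p^{5}))=\frac{(3p^3-5p^2+3p-1)\,\mathrm{sym}_{3,3,2}}{p^{14}}+\frac{(2p^3-4p^2+2p)\,\mathrm{sym}_{4,2,2}}{p^{14}}+\frac{(2p^3-3p^2+p)\,\mathrm{sym}_{4,3,1}}{p^{14}}+\frac{(p^3-p^2)\,\mathrm{sym}_{4,4,0}}{p^{14}}+\frac{(p^3-p^2)\,\mathrm{sym}_{5,2,1}}{p^{14}}+\frac{\mathrm{sym}_{5,3,0}}{p^{11}}$;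 20) $\omega(t(1,p^{4},p^{5}))=\frac{(2p^2-4p+2)\,\mathrm{sym}_{3,3,3}}{p^{15}}+\frac{(2p^2-3p+1)\,\mathrm{sym}_{4,3,2}}{p^{15}}+\frac{(2p^2-2p)\,\mathrm{sym}_{4,4,1}}{p^{15}}+\frac{(p^2-p)\,\mathrm{sym}_{5,2,2}}{p^{15}}+\frac{(p^2-p)\,\mathrm{sym}_{5,3,1}}{p^{15}}+\frac{\mathrm{sym}_{5,4,0}}{p^{13}}$; 21) $\omega(t(1,p^{5},p^{5}))=\frac{(p^2-2p+1)\,\mathrm{sym}_{4,3,3}}{p^{17}}+\frac{(p^2-2p+1)\,\mathrm{sym}_{4,4,2}}{p^{17}}+\frac{(p^2-p)\,\mathrm{sym}_{5,3,2}}{p^{17}}+\frac{(p^2-p)\,\mathrm{sym}_{5,4,1}}{p^{17}}+\frac{\mathrm{sym}_{5,5,0}}{p^{15}}$; 22) $\omega(t(1,1,p^{6}))=\frac{(p^2-2p+1)\,\mathrm{sym}_{2,2,2}}{p^{8}}+\frac{(p^2-2p+1)\,\mathrm{sym}_{3,2,1}}{p^{8}}+\frac{(p^2-p)\,\mathrm{sym}_{3,3,0}}{p^{8}}+\frac{(p^2-2p+1)\,\mathrm{sym}_{4,1,1}}{p^{8}}+\frac{(p^2-p)\,\mathrm{sym}_{4,2,0}}{p^{8}}+\frac{(p^2-p)\,\mathrm{sym}_{5,1,0}}{p^{8}}+\frac{\mathrm{sym}_{6,0,0}}{p^{6}}$;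 23) $\omega(t(1,p,p^{6}))=\frac{(2p^2-4p+2)\,\mathrm{sym}_{3,2,2}}{p^{10}}+\frac{(2p^2-3p+1)\,\mathrm{sym}_{3,3,1}}{p^{10}}+\frac{(2p^2-3p+1)\,\mathrm{sym}_{4,2,1}}{p^{10}}+\frac{(p^2-p)\,\mathrm{sym}_{4,3,0}}{p^{10}}+\frac{(2p^2-2p)\,\mathrm{sym}_{5,1,1}}{p^{10}}+\frac{(p^2-p)\,\mathrm{sym}_{5,2,0}}{p^{10}}+\frac{\mathrm{sym}_{6,1,0}}{p^{8}}$; 24) $\omega(t(1,p^{2},p^{6}))=\frac{(3p^3-6p^2+4p-1)\,\mathrm{sym}_{3,3,2}}{p^{13}}+\frac{(3p^3-5p^2+3p-1)\,\mathrm{sym}_{4,2,2}}{p^{13}}+\frac{(2p^3-4p^2+2p)\,\mathrm{sym}_{4,3,1}}{p^{13}}+\frac{(p^3-p^2)\,\mathrm{sym}_{4,4,0}}{p^{13}}+\frac{(2p^3-3p^2+p)\,\mathrm{sym}_{5,2,1}}{p^{13}}+\frac{(p^3-p^2)\,\mathrm{sym}_{5,3,0}}{p^{13}}+\frac{(p^3-p^2)\,\mathrm{sym}_{6,1,1}}{p^{13}}+\frac{\mathrm{sym}_{6,2,0}}{p^{10}}$;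 25) $\omega(t(1,p^{3},p^{6}))=\frac{(4p^3-7p^2+5p-2)\,\mathrm{sym}_{3,3,3}}{p^{15}}+\frac{(3p^3-6p^2+4p-1)\,\mathrm{sym}_{4,3,2}}{p^{15}}+\frac{(2p^3-4p^2+2p)\,\mathrm{sym}_{4,4,1}}{p^{15}}+\frac{(2p^3-4p^2+2p)\,\mathrm{sym}_{5,2,2}}{p^{15}}+\frac{(2p^3-3p^2+p)\,\mathrm{sym}_{5,3,1}}{p^{15}}+\frac{(p^3-p^2)\,\mathrm{sym}_{5,4,0}}{p^{15}}+\frac{(p^3-p^2)\,\mathrm{sym}_{6,2,1}}{p^{15}}+\frac{\mathrm{sym}_{6,3,0}}{p^{12}}$; 26) $\omega(t(1,p^{4},p^{6}))=\frac{(3p^3-6p^2+4p-1)\,\mathrm{sym}_{4,3,3}}{p^{17}}+\frac{(3p^3-5p^2+3p-1)\,\mathrm{sym}_{4,4,2}}{p^{17}}+\frac{(2p^3-4p^2+2p)\,\mathrm{sym}_{5,3,2}}{p^{17}}+\frac{(2p^3-3p^2+p)\,\mathrm{sym}_{5,4,1}}{p^{17}}+\frac{(p^3-p^2)\,\mathrm{sym}_{5,5,0}}{p^{17}}+\frac{(p^3-p^2)\,\mathrm{sym}_{6,2,2}}{p^{17}}+\frac{(p^3-p^2)\,\mathrm{sym}_{6,3,1}}{p^{17}}+\frac{\mathrm{sym}_{6,4,0}}{p^{14}}$;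 27) $\omega(t(1,p^{5},p^{6}))=\frac{(2p^2-4p+2)\,\mathrm{sym}_{4,4,3}}{p^{18}}+\frac{(2p^2-3p+1)\,\mathrm{sym}_{5,3,3}}{p^{18}}+\frac{(2p^2-3p+1)\,\mathrm{sym}_{5,4,2}}{p^{18}}+\frac{(2p^2-2p)\,\mathrm{sym}_{5,5,1}}{p^{18}}+\frac{(p^2-p)\,\mathrm{sym}_{6,3,2}}{p^{18}}+\frac{(p^2-p)\,\mathrm{sym}_{6,4,1}}{p^{18}}+\frac{\mathrm{sym}_{6,5,0}}{p^{16}}$; 28) $\omega(t(1,p^{6},p^{6}))=\frac{(p^2-2p+1)\,\mathrm{sym}_{4,4,4}}{p^{20}}+\frac{(p^2-2p+1)\,\mathrm{sym}_{5,4,3}}{p^{20}}+\frac{(p^2-2p+1)\,\mathrm{sym}_{5,5,2}}{p^{20}}+\frac{(p^2-p)\,\mathrm{sym}_{6,3,3}}{p^{20}}+\frac{(p^2-p)\,\mathrm{sym}_{6,4,2}}{p^{20}}+\frac{(p^2-p)\,\mathrm{sym}_{6,5,1}}{p^{20}}+\frac{\mathrm{sym}_{6,6,0}}{p^{18}}$.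 -/

import Mathlib

open scoped MatrixGroups

noncomputable section

namespace GLHecke

/-- The ring `ℤ[1/p]`, as a subring of `ℚ`. -/
def zInv (p : ℕ) : Subring ℚ := Subring.closure {(p : ℚ)⁻¹}

/-- `Λ = GL_n(ℤ)`, as a subgroup of `GL_n(ℚ)`. -/
def Lam (n : ℕ) : Subgroup (GL (Fin n) ℚ) :=
  (Matrix.GeneralLinearGroup.map (n := Fin n) (Int.castRingHom ℚ)).range

/-- `G_p = GL_n(ℤ[1/p])`, as a subgroup of `GL_n(ℚ)`. -/
def Gp (n p : ℕ) : Subgroup (GL (Fin n) ℚ) :=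
  (Matrix.GeneralLinearGroup.map (n := Fin n) (zInv p).subtype).range

/-- The Hecke ring `L_ℚ(Λ, G_p)` (as a `ℚ`-module): finite `ℚ`-linear combinations of the double
cosets `Λ g Λ` with `g ∈ G_p`. -/
abbrev LQ (n p : ℕ) : Type := HeckeRing (Gp n p).toSubmonoid (Lam n) ℚ

/-- `p` as a unit of `ℤ[1/p]`. -/
def pUnit (p : ℕ) [Fact p.Prime] : (zInv p)ˣ where
  val := (p : zInv p)
  inv := ⟨(p : ℚ)⁻¹, Subring.subset_closure rfl⟩
  val_inv := Subtype.ext (by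
    have h : (p : ℚ) ≠ 0 := Nat.cast_ne_zero.mpr (Fact.out : p.Prime).ne_zero
    simp [h])
  inv_val := Subtype.ext (by
    have h : (p : ℚ) ≠ 0 := Nat.cast_ne_zero.mpr (Fact.out : p.Prime).ne_zero
    simp [h])

/-- The invertible diagonal matrix with given units on the diagonal. -/
def diagGL {n : ℕ} {R : Type*} [CommRing R] (u : Fin n → Rˣ) : GL (Fin n) R where
  val := Matrix.diagonal fun i => (u i : R)
  inv := Matrix.diagonal fun i => ((u i)⁻¹ : Rˣ)
  val_inv := by simp
  inv_val := by simp

/-- `diag(p^{δ_1}, …, p^{δ_n})` as an element of `G_p`. -/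
def diagP {n : ℕ} (p : ℕ) [Fact p.Prime] (δ : Fin n → ℤ) : (Gp n p).toSubmonoid :=
  ⟨Matrix.GeneralLinearGroup.map (zInv p).subtype (diagGL fun i => pUnit p ^ δ i), ⟨_, rfl⟩⟩

/-- The Hecke operator `t(p^{δ_1}, …, p^{δ_n})`: the double coset
`Λ diag(p^{δ_1}, …, p^{δ_n}) Λ`, with coefficient `1`, as an element of the Hecke ring. -/
def t {n : ℕ} (p : ℕ) [Fact p.Prime] (δ : Fin n → ℤ) : LQ n p :=
  HeckeCosetModule.of (Finsupp.single (HeckeCoset.mk (Lam n) (Lam n) (diagP p δ)) 1)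

/-- The field `ℚ(x_1, …, x_n)` of rational functions; it contains the Laurent polynomials, in which
the spherical map takes its values. -/
def RatFun (n : ℕ) : Type := FractionRing (MvPolynomial (Fin n) ℚ)

instance (n : ℕ) : Field (RatFun n) :=
  inferInstanceAs (Field (FractionRing (MvPolynomial (Fin n) ℚ)))

instance (n : ℕ) : Algebra (MvPolynomial (Fin n) ℚ) (RatFun n) :=
  inferInstanceAs (Algebra (MvPolynomial (Fin n) ℚ) (FractionRing (MvPolynomial (Fin n) ℚ)))

instance (n : ℕ) : IsFractionRing (MvPolynomial (Fin n) ℚ) (RatFun n) :=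
  inferInstanceAs (IsFractionRing (MvPolynomial (Fin n) ℚ)
    (FractionRing (MvPolynomial (Fin n) ℚ)))

/-- The variables; `x i` is `x_{i+1}` when the variables are numbered from `1`. -/
def x {n : ℕ} (i : Fin n) : RatFun n := algebraMap (MvPolynomial (Fin n) ℚ) (RatFun n)
  (MvPolynomial.X i)

/-- The cosets `Λ g`, `g ∈ GL_n(ℚ)`. -/
abbrev Coset (n : ℕ) : Type := Quotient (QuotientGroup.rightRel (Lam n))

/-- The coset `Λ g`. -/
abbrev Coset.mk {n : ℕ} (g : GL (Fin n) ℚ) : Coset n :=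
  Quotient.mk (QuotientGroup.rightRel (Lam n)) g

/-- The coset `c` contains an upper triangular matrix with diagonal `p^{δ_1}, …, p^{δ_n}`. -/
def HasDiag {n : ℕ} (p : ℕ) (c : Coset n) (δ : Fin n → ℤ) : Prop :=
  ∃ g : GL (Fin n) ℚ, Coset.mk g = c ∧ (∀ i j : Fin n, j < i → g i j = 0) ∧
    ∀ i : Fin n, g i i = (p : ℚ) ^ δ i

open Classical in
/-- The spherical map on cosets: `ω(Λ g) = ∏ (x_i p^{-i})^{δ_i}` (with `i` from `1` to `n`) for an
upper triangular matrix `g` with diagonal `p^{δ_1}, …, p^{δ_n}`. Every coset `Λ g` with `g ∈ G_p`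
contains such a matrix, and the exponents are unique (`HasDiag.unique`). -/
def ωCoset {n : ℕ} (p : ℕ) (c : Coset n) : RatFun n :=
  if h : ∃ δ : Fin n → ℤ, HasDiag p c δ then
    ∏ i : Fin n, (x i / (p : RatFun n) ^ ((i : ℕ) + 1)) ^ h.choose i
  else 0

/-- The set of the cosets `Λ g_j` into which a double coset `Λ g Λ` decomposes. -/
def cosets {n p : ℕ} (D : HeckeCoset (Gp n p).toSubmonoid (Lam n) (Lam n)) : Set (Coset n) :=
  {c | ∃ g : (Gp n p).toSubmonoid, HeckeCoset.mk (Lam n) (Lam n) g = D ∧ Coset.mk g.1 = c}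

/-- The spherical map `ω` on the Hecke ring: if `T = ∑ a_j (Λ g_j)` is the decomposition into
cosets, then `ω(T) = ∑ a_j ω(Λ g_j)`. (Double cosets are finite unions of cosets.) -/
def ω {n : ℕ} (p : ℕ) (T : LQ n p) : RatFun n :=
  Finsupp.sum (HeckeCosetModule.of.symm T) fun D a =>
    (a : RatFun n) * ∑ᶠ c ∈ cosets D, ωCoset p c

/-- The monomial symmetric polynomial `sym_{i,j,k}` in `x_1, x_2, x_3`: the sum of the distinct
monomials obtained from `x_1^i x_2^j x_3^k` by permuting the variables. -/
def sym (i j k : ℕ) : RatFun 3 :=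
  ∑ m ∈ (Finset.univ : Finset (Equiv.Perm (Fin 3))).image fun σ l => ![i, j, k] (σ l),
    ∏ l : Fin 3, x l ^ m l

theorem HasDiag.le {n p : ℕ} (hp : p.Prime) {c : Coset n} {δ ε : Fin n → ℤ}
    (h : HasDiag p c δ) (h' : HasDiag p c ε) (i : Fin n) : δ i ≤ ε i := by
  obtain ⟨g, rfl, hg, hgd⟩ := h
  obtain ⟨g', he, hg', hgd'⟩ := h'
  obtain ⟨γ, hγ⟩ : g' * g⁻¹ ∈ Lam n := by
    have := QuotientGroup.rightRel_apply.mp (Quotient.exact he.symm)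
    exact this
  have e : g'.val = (Matrix.GeneralLinearGroup.map (Int.castRingHom ℚ) γ).val * g.val := by
    rw [hγ, ← Units.val_mul]; simp
  have hT : Matrix.BlockTriangular g.val id := fun i j hij => hg i j hij
  have hT' : Matrix.BlockTriangular g'.val id := fun i j hij => hg' i j hij
  have : Invertible g.val := g.isUnit.invertible
  have hTi : Matrix.BlockTriangular (g⁻¹).val id := by
    have := Matrix.blockTriangular_inv_of_blockTriangular hT
    rwa [← Matrix.coe_units_inv] at this
  have hΓ : Matrix.BlockTriangular
      (Matrix.GeneralLinearGroup.map (Int.castRingHom ℚ) γ).val id := by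
    rw [hγ, Units.val_mul]; exact hT'.mul hTi
  have hd : (p : ℚ) ^ ε i = ((γ.val i i : ℤ) : ℚ) * (p : ℚ) ^ δ i := by
    rw [← hgd, ← hgd', e, Matrix.mul_apply, Finset.sum_eq_single i]
    · rfl
    · intro j _ hj
      rcases lt_or_gt_of_ne hj with h | h
      · rw [hΓ h, zero_mul]
      · rw [hT h, mul_zero]
    · simp
  have hp1 : (1 : ℚ) < p := by exact_mod_cast hp.one_lt
  have hp0 : (0 : ℚ) < p := by linarith
  have hγ1 : (1 : ℚ) ≤ ((γ.val i i : ℤ) : ℚ) := by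
    have : (0 : ℚ) < ((γ.val i i : ℤ) : ℚ) := by
      have h1 : (0 : ℚ) < (p : ℚ) ^ ε i := zpow_pos hp0 _
      rw [hd] at h1
      exact pos_of_mul_pos_left h1 (zpow_pos hp0 _).le
    exact_mod_cast this
  have : (p : ℚ) ^ δ i ≤ (p : ℚ) ^ ε i := by
    rw [hd]
    exact le_mul_of_one_le_left (zpow_pos hp0 _).le hγ1
  exact (zpow_le_zpow_iff_right₀ hp1).mp this

/-- The exponents `δ_1, …, δ_n` of a coset are unique. -/
theorem HasDiag.unique {n p : ℕ} (hp : p.Prime) {c : Coset n} {δ ε : Fin n → ℤ}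
    (h : HasDiag p c δ) (h' : HasDiag p c ε) : δ = ε :=
  funext fun i => le_antisymm (h.le hp h' i) (h'.le hp h i)

end GLHecke

end

open GLHecke

/-!
The cosets `Λ g` in a double coset of integral matrices are represented by the Hermite normal forms
that it contains, and the double coset of an integral matrix of size three whose determinant is a
power of `p` is determined by this determinant, the greatest common divisor of the entries and that
of the minors of order two. So `ω(t(1, p^a, p^b))` amounts to counting, for all diagonals
`p^{d_0}, p^{d_1}, p^{d_2}` of determinant `p^{a+b}`, the Hermite normal forms whose entries are not
all divisible by `p` and whose minors have greatest common divisor `p^a`. If `x`, `y`, `z` are the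
entries at the places `(0, 1)`, `(1, 2)`, `(0, 2)`, the minors are divisible by `p^k` if and only if
`x` and `y` are divisible by `p^{k-d_2}` and `p^{k-d_0}` and `z` solves `p^{d_1} z ≡ x y` modulo
`p^k`. Hence one has to count the pairs `(x, y)` with a prescribed power of `p` dividing `x y`, and
the type then follows by inclusion and exclusion. The proportion of the forms of a given type is a
symmetric function of `(d_0, d_1, d_2)`, while the number `p^{d_1 + 2 d_2}` of all forms cancels the
asymmetry of the weights `(x_i p^{-i})^{d_i}` up to the factor `p^{-(a+b)}`; this makes the sum a
combination of the `sym_{i,j,k}`.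
-/

namespace GLHecke

section Counting

open Finset

theorem filter_dvd_Ico_zero_mul {a : ℤ} (ha : 0 < a) (b : ℤ) :
    {x ∈ Ico 0 (a * b) | a ∣ x} = (Ico 0 b).image (a * ·) := by
  ext x
  simp only [mem_filter, mem_Ico, mem_image]
  constructor
  · rintro ⟨⟨h0, hb⟩, y, rfl⟩
    exact ⟨y, ⟨nonneg_of_mul_nonneg_right h0 ha, lt_of_mul_lt_mul_left hb ha.le⟩, rfl⟩
  · rintro ⟨y, ⟨h0, hb⟩, rfl⟩
    exact ⟨⟨mul_nonneg ha.le h0, mul_lt_mul_of_pos_left hb ha⟩, dvd_mul_right a y⟩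

theorem sum_filter_dvd_Ico_zero_mul {M : Type*} [AddCommMonoid M] {a : ℤ} (ha : 0 < a) (b : ℤ)
    (f : ℤ → M) : ∑ x ∈ Ico 0 (a * b) with a ∣ x, f x = ∑ y ∈ Ico 0 b, f (a * y) := by
  rw [filter_dvd_Ico_zero_mul ha, sum_image (mul_right_injective₀ ha.ne').injOn]

theorem card_filter_dvd_sub_Ico_zero_mul {a b : ℤ} (ha : 0 < a) (hb : 0 ≤ b) (c : ℤ) :
    (#{x ∈ Ico 0 (a * b) | a ∣ c - x} : ℤ) = b := by
  have hcount := Int.Ico_filter_modEq_card 0 (a * b) ha c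
  simp only [Int.modEq_iff_dvd] at hcount
  have hshift : ((a * b : ℤ) - c : ℚ) / a = ((0 : ℤ) - c) / a + b := by
    have : (a : ℚ) ≠ 0 := by exact_mod_cast ha.ne'
    push_cast
    field_simp
    ring
  rw [hcount, hshift, Int.ceil_add_intCast, add_sub_cancel_left, max_eq_left hb]

theorem card_filter_dvd_Ico_zero_mul {a b : ℤ} (ha : 0 < a) (hb : 0 ≤ b) :
    (#{x ∈ Ico 0 (a * b) | a ∣ x} : ℤ) = b := by
  simpa using card_filter_dvd_sub_Ico_zero_mul ha hb 0

variable {p : ℤ}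

theorem card_filter_pow_dvd_sub_pow_mul (hp : 0 < p) {k d n : ℕ} (h : k ≤ d + n) (c : ℤ) :
    (#{w ∈ Ico 0 (p ^ n) | p ^ k ∣ c - p ^ d * w} : ℤ) =
      if p ^ min k d ∣ c then p ^ (n - (k - d)) else 0 := by
  split_ifs with hc
  · rcases le_total k d with hkd | hkd
    · rw [min_eq_left hkd] at hc
      have hall (w : ℤ) : p ^ k ∣ c - p ^ d * w := dvd_sub hc ((pow_dvd_pow p hkd).mul_right w)
      simp [hall, Nat.sub_eq_zero_of_le hkd, hp.le]
    · rw [min_eq_right hkd] at hc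
      obtain ⟨c, rfl⟩ := hc
      obtain ⟨j, rfl⟩ := Nat.exists_eq_add_of_le hkd
      obtain ⟨l, rfl⟩ := Nat.exists_eq_add_of_le (Nat.add_le_add_iff_left.1 h)
      simp only [← mul_sub, pow_add p d, mul_dvd_mul_iff_left (pow_pos hp d).ne', pow_add p j,
        add_tsub_cancel_left]
      exact card_filter_dvd_sub_Ico_zero_mul (pow_pos hp j) (pow_pos hp l).le c
  · rw [Nat.cast_eq_zero, card_eq_zero, filter_eq_empty_iff]
    intro w _ hw
    have hd : p ^ min k d ∣ p ^ d * w := (pow_dvd_pow p (min_le_right k d)).mul_right w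
    exact hc ((dvd_sub_left hd).1 ((pow_dvd_pow p (min_le_left k d)).trans hw))

theorem card_filter_not_dvd_Ico_zero_pow_succ (hp : 0 < p) (m : ℕ) :
    (#{x ∈ Ico 0 (p ^ (m + 1)) | ¬ p ∣ x} : ℤ) = p ^ (m + 1) - p ^ m := by
  have hdvd := card_filter_dvd_Ico_zero_mul hp (pow_pos hp m).le
  have hall := card_filter_add_card_filter_not (s := Ico 0 (p ^ (m + 1))) (p ∣ ·)
  rw [← pow_succ'] at hdvd
  rw [Int.card_Ico, sub_zero] at hall
  have := Int.toNat_of_nonneg (pow_pos hp (m + 1)).le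
  omega

variable {K : Type*} [Field K] [CharZero K]

theorem sum_card_filter_pow_dvd_mul (hp : 0 < p) (hprime : Prime p) {m n r : ℕ} (hm : r ≤ m)
    (hn : r ≤ n) : (∑ x ∈ Ico 0 (p ^ m), #{y ∈ Ico 0 (p ^ n) | p ^ r ∣ x * y} : K) =
      p ^ (m + n) * (((r + 1 : ℕ) - (r : ℕ) / (p : K)) / p ^ r) := by
  have hpK : (p : K) ≠ 0 := by exact_mod_cast hp.ne'
  have cast_toNat (k : ℕ) : ((p ^ k).toNat : K) = p ^ k := by
    exact_mod_cast congrArg (Int.cast : ℤ → K) (Int.toNat_of_nonneg (pow_pos hp k).le)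
  induction r generalizing m with
  | zero => simp [pow_add, cast_toNat]
  | succ r ih =>
    obtain ⟨m, rfl⟩ := Nat.exists_eq_add_one_of_ne_zero (Nat.ne_zero_of_lt hm)
    obtain ⟨n, rfl⟩ := Nat.exists_eq_add_of_le hn
    have hdvd : ∑ x ∈ Ico 0 (p ^ (m + 1)) with p ∣ x,
        (#{y ∈ Ico 0 (p ^ (r + 1 + n)) | p ^ (r + 1) ∣ x * y} : K) =
        ∑ x ∈ Ico 0 (p ^ m), (#{y ∈ Ico 0 (p ^ (r + 1 + n)) | p ^ r ∣ x * y} : K) := by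
      simp only [pow_succ' _ m, sum_filter_dvd_Ico_zero_mul hp, pow_succ' _ r, mul_assoc,
        mul_dvd_mul_iff_left hp.ne']
    have hnot_dvd (x : ℤ) (hx : x ∈ {x ∈ Ico 0 (p ^ (m + 1)) | ¬ p ∣ x}) :
        (#{y ∈ Ico 0 (p ^ (r + 1 + n)) | p ^ (r + 1) ∣ x * y} : K) = p ^ n := by
      have hiff (y : ℤ) : p ^ (r + 1) ∣ x * y ↔ p ^ (r + 1) ∣ y :=
        ⟨hprime.pow_dvd_of_dvd_mul_left _ (mem_filter.1 hx).2, fun h => h.mul_left x⟩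
      simp only [hiff, pow_add p (r + 1)]
      exact_mod_cast congrArg (Int.cast : ℤ → K)
        (card_filter_dvd_Ico_zero_mul (pow_pos hp (r + 1)) (pow_pos hp n).le)
    have hcard : (#{x ∈ Ico 0 (p ^ (m + 1)) | ¬ p ∣ x} : K) = p ^ (m + 1) - p ^ m := by
      exact_mod_cast congrArg (Int.cast : ℤ → K) (card_filter_not_dvd_Ico_zero_pow_succ hp m)
    rw [← sum_filter_add_sum_filter_not (Ico 0 (p ^ (m + 1))) (p ∣ ·), hdvd,
      ih (by omega) (by omega), sum_congr rfl hnot_dvd, sum_const, nsmul_eq_mul, hcard]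
    push_cast
    field_simp
    ring

end Counting

section EntrywiseDvd

variable {n R : Type*} [Fintype n] [DecidableEq n] [CommRing R]

/-- All entries of `M` are divisible by `c`. -/
def EntrywiseDvd (c : R) (M : Matrix n n R) : Prop :=
  ∀ i j, c ∣ M i j

variable {c : R} {M A B : Matrix n n R}

omit [DecidableEq n] in
theorem EntrywiseDvd.mul_mul (h : EntrywiseDvd c M) (A B : Matrix n n R) :
    EntrywiseDvd c (A * M * B) := fun _ _ =>
  Finset.dvd_sum fun k _ => (Finset.dvd_sum fun l _ => (h l k).mul_left _).mul_right _

theorem entrywiseDvd_mul_mul_iff (hA : IsUnit A) (hB : IsUnit B) :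
    EntrywiseDvd c (A * M * B) ↔ EntrywiseDvd c M := by
  refine ⟨fun h => ?_, fun h => h.mul_mul A B⟩
  obtain ⟨A, rfl⟩ := hA
  obtain ⟨B, rfl⟩ := hB
  simpa [mul_assoc] using h.mul_mul (A⁻¹).val (B⁻¹).val

theorem entrywiseDvd_adjugate_mul_mul_iff (hA : IsUnit A) (hB : IsUnit B) :
    EntrywiseDvd c (A * M * B).adjugate ↔ EntrywiseDvd c M.adjugate := by
  have isUnit_adjugate {N : Matrix n n R} (hN : IsUnit N) : IsUnit N.adjugate := by
    rw [Matrix.isUnit_iff_isUnit_det, Matrix.det_adjugate]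
    exact ((Matrix.isUnit_iff_isUnit_det N).1 hN).pow _
  rw [Matrix.adjugate_mul_distrib, Matrix.adjugate_mul_distrib, ← mul_assoc]
  exact entrywiseDvd_mul_mul_iff (isUnit_adjugate hB) (isUnit_adjugate hA)

/-- The entries of the integral matrix `M` are not all divisible by `p`, and the greatest common
divisor of the entries of its adjugate has `p`-adic valuation `a`. These are the invariants of the
double coset of `M` in size three. -/
def HasType (p : ℤ) (a : ℕ) (M : Matrix n n ℤ) : Prop :=
  ¬ EntrywiseDvd p M ∧ EntrywiseDvd (p ^ a) M.adjugate ∧ ¬ EntrywiseDvd (p ^ (a + 1)) M.adjugate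

theorem hasType_mul_mul_iff {p : ℤ} {a : ℕ} {M A B : Matrix n n ℤ} (hA : IsUnit A)
    (hB : IsUnit B) : HasType p a (A * M * B) ↔ HasType p a M := by
  simp only [HasType, entrywiseDvd_mul_mul_iff hA hB, entrywiseDvd_adjugate_mul_mul_iff hA hB]

end EntrywiseDvd

section ElementaryDivisors

variable {n : Type*} [Fintype n] [DecidableEq n]

omit [Fintype n] in
theorem entrywiseDvd_diagonal_iff {R : Type*} [CommRing R] {c : R} {v : n → R} :
    EntrywiseDvd c (Matrix.diagonal v) ↔ ∀ i, c ∣ v i := by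
  refine ⟨fun h i => by simpa using h i i, fun h i j => ?_⟩
  rcases eq_or_ne i j with rfl | hij
  · simpa using h i
  · simp [Matrix.diagonal_apply_ne _ hij]

theorem hasType_diagonal_pow_iff {p : ℤ} (hp : Prime p) {e : Fin 3 → ℕ} (he : Monotone e) {a : ℕ} :
    HasType p a (Matrix.diagonal fun i => p ^ e i) ↔ e 0 = 0 ∧ e 1 = a := by
  have h01 : e 0 ≤ e 1 := he (by decide)
  have h12 : e 1 ≤ e 2 := he (by decide)
  have hentries : EntrywiseDvd p (Matrix.diagonal fun i => p ^ e i) ↔ 1 ≤ e 0 := by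
    have hdvd (k : ℕ) : p ∣ p ^ k ↔ 1 ≤ k := by
      rw [← pow_dvd_pow_iff hp.ne_zero hp.not_isUnit, pow_one]
    simp only [entrywiseDvd_diagonal_iff, hdvd, Fin.forall_fin_succ, Fin.succ_zero_eq_one,
      Fin.succ_one_eq_two, IsEmpty.forall_iff, and_true]
    omega
  have hadjugate (k : ℕ) :
      EntrywiseDvd (p ^ k) (Matrix.diagonal fun i => p ^ e i).adjugate ↔ k ≤ e 0 + e 1 := by
    simp only [Matrix.adjugate_diagonal, entrywiseDvd_diagonal_iff, Finset.prod_pow_eq_pow_sum,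
      pow_dvd_pow_iff hp.ne_zero hp.not_isUnit, Fin.forall_fin_succ, Fin.succ_zero_eq_one,
      Fin.succ_one_eq_two, IsEmpty.forall_iff, and_true]
    have hsum (i : Fin 3) : ∑ j ∈ Finset.univ.erase i, e j + e i = e 0 + e 1 + e 2 := by
      rw [Finset.sum_erase_add _ _ (Finset.mem_univ i), Fin.sum_univ_three]
    have h0 := hsum 0
    have h1 := hsum 1
    have h2 := hsum 2
    omega
  rw [HasType, hentries, hadjugate, hadjugate]
  omega

theorem exists_eq_mul_diagonal_mul (M : Matrix n n ℤ) (hM : M.det ≠ 0) :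
    ∃ (A B : Matrix n n ℤ) (d : n → ℤ), IsUnit A ∧ IsUnit B ∧ M = A * Matrix.diagonal d * B := by
  have hrows : LinearIndependent ℤ M.row := Matrix.linearIndependent_rows_of_det_ne_zero hM
  let rows := Module.Basis.span hrows
  have hrank : Module.finrank ℤ (Submodule.span ℤ (Set.range M.row)) =
      Module.finrank ℤ (n → ℤ) := by
    rw [Module.finrank_eq_card_basis rows, Module.finrank_fintype_fun_eq_card]
  obtain ⟨b', d, b, hb⟩ := Submodule.exists_smith_normal_form_of_rank_eq (Pi.basisFun ℤ n) hrank
  have := b.invertibleToMatrix rows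
  have := (Pi.basisFun ℤ n).invertibleToMatrix b'
  refine ⟨(b.toMatrix rows).transpose, ((Pi.basisFun ℤ n).toMatrix b').transpose, d,
    isUnit_of_invertible _, isUnit_of_invertible _, ?_⟩
  ext i j
  calc M i j = (rows i : n → ℤ) j := by rw [Module.Basis.span_apply]; rfl
    _ = ((∑ k, b.toMatrix rows k i • b k : Submodule.span ℤ (Set.range M.row)) : n → ℤ) j := by
      rw [b.sum_toMatrix_smul_self]
    _ = _ := by
      rw [Matrix.mul_apply]
      simp only [Submodule.coe_sum, Submodule.coe_smul, hb, Finset.sum_apply, Pi.smul_apply,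
        Matrix.mul_diagonal, Matrix.transpose_apply, Module.Basis.toMatrix_apply,
        Pi.basisFun_repr, smul_eq_mul, mul_assoc]

theorem natAbs_det_of_isUnit {A : Matrix n n ℤ} (hA : IsUnit A) : A.det.natAbs = 1 :=
  Int.isUnit_iff_natAbs_eq.1 ((Matrix.isUnit_iff_isUnit_det A).1 hA)

omit [DecidableEq n] in
theorem exists_eq_units_mul_pow_of_natAbs_prod_eq {p m : ℕ} (hp : p.Prime) {d : n → ℤ}
    (hd : (∏ i, d i).natAbs = p ^ m) :
    ∃ (s : n → ℤˣ) (e : n → ℕ), (∀ i, d i = s i * (p : ℤ) ^ e i) ∧ ∑ i, e i = m := by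
  have hpow (i : n) : ∃ e : ℕ, (d i).natAbs = p ^ e := by
    obtain ⟨e, -, he⟩ := (Nat.dvd_prime_pow hp).1
      (hd ▸ Int.natAbs_dvd_natAbs.2 (Finset.dvd_prod_of_mem d (Finset.mem_univ i)))
    exact ⟨e, he⟩
  choose e he using hpow
  have hsign (i : n) : ∃ s : ℤˣ, d i = s * (p : ℤ) ^ e i := by
    rcases Int.natAbs_eq (d i) with h | h <;> rw [he] at h
    · exact ⟨1, by simp [h]⟩
    · exact ⟨-1, by simp [h]⟩
  choose s hs using hsign
  refine ⟨s, e, hs, Nat.pow_right_injective hp.two_le ?_⟩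
  change p ^ ∑ i, e i = p ^ m
  rw [← hd, ← Finset.prod_pow_eq_pow_sum, ← Int.natAbsHom_apply, map_prod]
  exact Finset.prod_congr rfl fun i _ => (he i).symm

theorem exists_mul_diagonal_pow_mul {k m p : ℕ} (hp : p.Prime) (M : Matrix (Fin k) (Fin k) ℤ)
    (hM : M.det.natAbs = p ^ m) :
    ∃ (A B : Matrix (Fin k) (Fin k) ℤ) (e : Fin k → ℕ), IsUnit A ∧ IsUnit B ∧ Monotone e ∧
      ∑ i, e i = m ∧ M = A * Matrix.diagonal (fun i => (p : ℤ) ^ e i) * B := by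
  obtain ⟨A, B, d, hA, hB, rfl⟩ := exists_eq_mul_diagonal_mul M (by
    rw [← Int.natAbs_ne_zero, hM]; exact (pow_pos hp.pos _).ne')
  obtain ⟨s, e, hd, hsum⟩ := exists_eq_units_mul_pow_of_natAbs_prod_eq (d := d) (m := m) hp (by
    simpa [Int.natAbs_mul, natAbs_det_of_isUnit hA, natAbs_det_of_isUnit hB] using hM)
  have hdiag : Matrix.diagonal d =
      (diagGL s).val * Matrix.diagonal fun i => (p : ℤ) ^ e i := by
    simp only [diagGL, Matrix.diagonal_mul_diagonal, ← hd]
  let σ := Tuple.sort e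
  refine ⟨(A * (diagGL s).val).submatrix id σ, B.submatrix σ id, e ∘ σ, ?_, ?_,
    Tuple.monotone_sort e, (Equiv.sum_comp σ e).trans hsum, ?_⟩
  · exact (Matrix.isUnit_submatrix_equiv (Equiv.refl _) σ).2 (hA.mul (diagGL s).isUnit)
  · exact (Matrix.isUnit_submatrix_equiv σ (Equiv.refl _)).2 hB
  · have hsort : Matrix.diagonal (fun i => (p : ℤ) ^ (e ∘ σ) i) =
        (Matrix.diagonal fun i => (p : ℤ) ^ e i).submatrix σ σ :=
      (Matrix.submatrix_diagonal_equiv (fun i => (p : ℤ) ^ e i) σ).symm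
    rw [hsort, Matrix.submatrix_mul_equiv, Matrix.submatrix_mul_equiv, Matrix.submatrix_id_id,
      hdiag, ← mul_assoc A]

/-- `M` and `N` lie in the same double coset of `GL_n(ℤ)`. -/
def UnimodularEquiv (M N : Matrix n n ℤ) : Prop :=
  ∃ A B : GL n ℤ, M = A.val * N * B.val

theorem UnimodularEquiv.natAbs_det {M N : Matrix n n ℤ} (h : UnimodularEquiv M N) :
    M.det.natAbs = N.det.natAbs := by
  obtain ⟨A, B, rfl⟩ := h
  rw [Matrix.det_mul, Matrix.det_mul, Int.natAbs_mul, Int.natAbs_mul,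
    natAbs_det_of_isUnit A.isUnit, natAbs_det_of_isUnit B.isUnit, one_mul, mul_one]

theorem UnimodularEquiv.mul_left {M N : Matrix n n ℤ} (h : UnimodularEquiv M N) (γ : GL n ℤ) :
    UnimodularEquiv (γ.val * M) N := by
  obtain ⟨A, B, rfl⟩ := h
  exact ⟨γ * A, B, by simp only [Units.val_mul, mul_assoc]⟩

theorem hasType_iff {p a b : ℕ} (hp : p.Prime) (hab : a ≤ b) {M : Matrix (Fin 3) (Fin 3) ℤ}
    (hM : M.det.natAbs = p ^ (a + b)) :
    HasType p a M ↔ UnimodularEquiv M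
      (Matrix.diagonal fun i => (p : ℤ) ^ (![0, a, b] : Fin 3 → ℕ) i) := by
  have hp' : Prime (p : ℤ) := Nat.prime_iff_prime_int.1 hp
  constructor
  · intro h
    obtain ⟨A, B, e, hA, hB, he, hsum, rfl⟩ := exists_mul_diagonal_pow_mul hp M hM
    obtain ⟨h0, h1⟩ := (hasType_diagonal_pow_iff hp' he).1 ((hasType_mul_mul_iff hA hB).1 h)
    have h2 : e 2 = b := by rw [Fin.sum_univ_three] at hsum; omega
    obtain rfl : e = ![0, a, b] := by ext i; fin_cases i <;> assumption
    exact ⟨hA.unit, hB.unit, rfl⟩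
  · rintro ⟨A, B, rfl⟩
    have hmono : Monotone (![0, a, b] : Fin 3 → ℕ) := by
      simp [Fin.monotone_iff_le_succ, Fin.forall_fin_succ, hab]
    exact (hasType_mul_mul_iff A.isUnit B.isUnit).2 ((hasType_diagonal_pow_iff hp' hmono).2
      ⟨rfl, rfl⟩)

end ElementaryDivisors

section HermiteNormalForm

variable {n : ℕ}

theorem det_eq_mul_det_submatrix_succ {R : Type*} [CommRing R]
    {M : Matrix (Fin (n + 1)) (Fin (n + 1)) R} (hM : ∀ i : Fin n, M i.succ 0 = 0) :
    M.det = M 0 0 * (M.submatrix Fin.succ Fin.succ).det := by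
  simp [Matrix.det_succ_column_zero, Fin.sum_univ_succ, hM]

theorem exists_isUnit_mulVec_succ_eq_zero (v : Fin (n + 1) → ℤ) :
    ∃ γ : Matrix (Fin (n + 1)) (Fin (n + 1)) ℤ, IsUnit γ ∧
      ∀ i : Fin n, (γ.mulVec v) i.succ = 0 := by
  obtain ⟨k, S⟩ := Submodule.smithNormalForm (Pi.basisFun ℤ (Fin (n + 1))) (Submodule.span ℤ {v})
  have hk : k ≤ 1 := by
    have := finrank_span_le_card (R := ℤ) {v}
    simpa [Module.finrank_eq_card_basis S.bN] using this
  obtain ⟨i₀, hi₀⟩ : ∃ i₀, ∀ i, i ≠ i₀ → S.bM.repr v i = 0 := by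
    rcases Nat.le_one_iff_eq_zero_or_eq_one.1 hk with rfl | rfl
    · exact ⟨0, fun i _ => S.repr_eq_zero_of_notMem_range
        ⟨v, Submodule.mem_span_singleton_self v⟩ (by rintro ⟨j, -⟩; exact j.elim0)⟩
    · exact ⟨S.f 0, fun i hi => S.repr_eq_zero_of_notMem_range
        ⟨v, Submodule.mem_span_singleton_self v⟩
        (by rintro ⟨j, rfl⟩; exact hi (congrArg S.f (Subsingleton.elim j 0)))⟩
  let b := S.bM.reindex (Equiv.swap i₀ 0)
  have := b.invertibleToMatrix (Pi.basisFun ℤ (Fin (n + 1)))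
  refine ⟨b.toMatrix (Pi.basisFun ℤ (Fin (n + 1))), isUnit_of_invertible _, fun i => ?_⟩
  have hrepr := (Pi.basisFun ℤ (Fin (n + 1))).toMatrix_mulVec_repr b v
  have hv : ⇑((Pi.basisFun ℤ (Fin (n + 1))).repr v) = v := by
    ext i
    simp
  rw [hv] at hrepr
  rw [hrepr, Module.Basis.repr_reindex_apply]
  exact hi₀ _ (by simp [Equiv.swap_apply_eq_iff, Fin.succ_ne_zero])

theorem exists_add_vecMul_reduced (H : Matrix (Fin n) (Fin n) ℤ)
    (htriang : ∀ i j, j < i → H i j = 0) (hpos : ∀ i, 0 < H i i) (w : Fin n → ℤ) :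
    ∃ u : Fin n → ℤ, ∀ j, 0 ≤ (w + Matrix.vecMul u H) j ∧ (w + Matrix.vecMul u H) j < H j j := by
  induction n with
  | zero => exact ⟨0, fun j => j.elim0⟩
  | succ n ih =>
    obtain ⟨u, hu⟩ := ih (H.submatrix Fin.succ Fin.succ)
      (fun i j hij => htriang _ _ (Fin.succ_lt_succ_iff.2 hij)) (fun i => hpos i.succ)
      fun j => w j.succ - w 0 / H 0 0 * H 0 j.succ
    refine ⟨Fin.cons (-(w 0 / H 0 0)) u, Fin.cases ?_ fun j => ?_⟩
    · have hmod : (w + Matrix.vecMul (Fin.cons (-(w 0 / H 0 0)) u) H) 0 = w 0 % H 0 0 := by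
        simp [Matrix.vecMul, dotProduct, Fin.sum_univ_succ, htriang _ _ (Fin.succ_pos _),
          Int.emod_def, mul_comm, sub_eq_add_neg]
      rw [hmod]
      exact ⟨Int.emod_nonneg _ (hpos 0).ne', Int.emod_lt_of_pos _ (hpos 0)⟩
    · simpa [Matrix.vecMul, dotProduct, Fin.sum_univ_succ, sub_eq_add_neg, add_assoc] using hu j

theorem exists_isUnit_mul_row_zero_succ {s : ℤ} (hs : IsUnit s) (r : Fin n → ℤ)
    {γ : Matrix (Fin n) (Fin n) ℤ} (hγ : IsUnit γ) :
    ∃ γ' : Matrix (Fin (n + 1)) (Fin (n + 1)) ℤ, IsUnit γ' ∧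
      ∀ (T : Matrix (Fin (n + 1)) (Fin (n + 1)) ℤ) (j : Fin (n + 1)),
        (γ' * T) 0 j = s * T 0 j + Matrix.vecMul r (T.submatrix Fin.succ id) j ∧
          ∀ i : Fin n, (γ' * T) i.succ j = (γ * T.submatrix Fin.succ id) i j := by
  refine ⟨Matrix.of (Fin.cons (Fin.cons s r) fun i => Fin.cons 0 (γ i)), ?_, fun T j => ?_⟩
  · rw [Matrix.isUnit_iff_isUnit_det, det_eq_mul_det_submatrix_succ fun i => rfl]
    exact hs.mul ((Matrix.isUnit_iff_isUnit_det γ).1 hγ)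
  · simp [Matrix.mul_apply, Fin.sum_univ_succ, Matrix.vecMul, dotProduct]

theorem exists_isUnit_mul_hermite (M : Matrix (Fin n) (Fin n) ℤ) (hM : M.det ≠ 0) :
    ∃ γ : Matrix (Fin n) (Fin n) ℤ, IsUnit γ ∧ (∀ i j, j < i → (γ * M) i j = 0) ∧
      (∀ i, 0 < (γ * M) i i) ∧ ∀ i j, i < j → 0 ≤ (γ * M) i j ∧ (γ * M) i j < (γ * M) j j := by
  induction n with
  | zero => exact ⟨1, isUnit_one, fun i => i.elim0, fun i => i.elim0, fun i => i.elim0⟩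
  | succ n ih =>
    obtain ⟨γ₁, hγ₁, hcol⟩ := exists_isUnit_mulVec_succ_eq_zero fun i => M i 0
    set T := γ₁ * M with hT
    replace hcol (i : Fin n) : T i.succ 0 = 0 := hcol i
    have hdet : T 0 0 * (T.submatrix Fin.succ Fin.succ).det ≠ 0 := by
      rw [← det_eq_mul_det_submatrix_succ hcol, hT, Matrix.det_mul]
      exact mul_ne_zero ((Matrix.isUnit_iff_isUnit_det γ₁).1 hγ₁).ne_zero hM
    obtain ⟨γ₂, hγ₂, hlower, hpos, hupper⟩ :=
      ih (T.submatrix Fin.succ Fin.succ) (right_ne_zero_of_mul hdet)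
    obtain ⟨u, hu⟩ := exists_add_vecMul_reduced _ hlower hpos
      fun j => (T 0 0).sign * T 0 j.succ
    have hsign : IsUnit (T 0 0).sign := by
      rw [Int.isUnit_iff_natAbs_eq, Int.natAbs_sign_of_ne_zero (left_ne_zero_of_mul hdet)]
    obtain ⟨γ₃, hγ₃, hrow⟩ := exists_isUnit_mul_row_zero_succ hsign (Matrix.vecMul u γ₂) hγ₂
    have hcorner : 0 < (γ₃ * T) 0 0 := by
      rw [(hrow T 0).1]
      simpa [Matrix.vecMul, dotProduct, hcol, Int.sign_mul_self_eq_abs] using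
        left_ne_zero_of_mul hdet
    have hcolumn (i : Fin n) : (γ₃ * T) i.succ 0 = 0 := by
      rw [(hrow T 0).2]
      simp [Matrix.mul_apply, hcol]
    have hblock (i j : Fin n) :
        (γ₃ * T) i.succ j.succ = (γ₂ * T.submatrix Fin.succ Fin.succ) i j := (hrow T j.succ).2 i
    have htop (j : Fin n) : (γ₃ * T) 0 j.succ = ((fun j : Fin n => (T 0 0).sign * T 0 j.succ) +
        Matrix.vecMul u (γ₂ * T.submatrix Fin.succ Fin.succ)) j := by
      rw [(hrow T j.succ).1, ← Matrix.vecMul_vecMul]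
      rfl
    refine ⟨γ₃ * γ₁, hγ₃.mul hγ₁, ?_⟩
    rw [mul_assoc, ← hT]
    simp only [Fin.forall_fin_succ, hcolumn, hblock, htop, Fin.succ_lt_succ_iff]
    exact ⟨by simpa using hlower, ⟨hcorner, hpos⟩, by simpa using ⟨hu, hupper⟩⟩

variable {p : ℤ} {d : Fin n → ℕ}

/-- The Hermite normal forms with diagonal entries `p ^ d i`: the integral upper triangular matrices
with this diagonal whose entries above the diagonal are reduced modulo the diagonal entry of their
column. -/
noncomputable def hermite (p : ℤ) (d : Fin n → ℕ) : Finset (Matrix (Fin n) (Fin n) ℤ) :=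
  Fintype.piFinset fun i => Fintype.piFinset fun j =>
    if i = j then {p ^ d j} else if i < j then Finset.Ico 0 (p ^ d j) else {0}

theorem mem_hermite {M : Matrix (Fin n) (Fin n) ℤ} :
    M ∈ hermite p d ↔ (∀ i j, j < i → M i j = 0) ∧ (∀ i, M i i = p ^ d i) ∧
      ∀ i j, i < j → 0 ≤ M i j ∧ M i j < p ^ d j := by
  have hmem : M ∈ hermite p d ↔
      ∀ i j, M i j ∈ if i = j then {p ^ d j} else if i < j then Finset.Ico 0 (p ^ d j) else {0} :=
    Fintype.mem_piFinset.trans (forall_congr' fun i => Fintype.mem_piFinset)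
  rw [hmem]
  constructor
  · intro h
    refine ⟨fun i j hij => ?_, fun i => ?_, fun i j hij => ?_⟩
    · simpa [hij.ne', hij.not_gt] using h i j
    · simpa using h i i
    · simpa [hij.ne, hij] using h i j
  · rintro ⟨hlower, hdiag, hupper⟩ i j
    rcases lt_trichotomy i j with hij | rfl | hij
    · simpa [hij.ne, hij] using hupper i j hij
    · simpa using hdiag i
    · simpa [hij.ne', hij.not_gt] using hlower i j hij

theorem det_of_mem_hermite {M : Matrix (Fin n) (Fin n) ℤ}
    (hM : M ∈ hermite p d) : M.det = p ^ ∑ i, d i := by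
  obtain ⟨hlower, hdiag, -⟩ := mem_hermite.1 hM
  rw [Matrix.det_of_isUpperTriangular fun i j hij => hlower i j hij, ← Finset.prod_pow_eq_pow_sum]
  exact Finset.prod_congr rfl fun i _ => hdiag i

theorem exists_mul_mem_hermite {p m : ℕ} (hp : p.Prime) (M : Matrix (Fin n) (Fin n) ℤ)
    (hM : M.det.natAbs = p ^ m) :
    ∃ (γ : GL (Fin n) ℤ) (d : Fin n → ℕ), ∑ i, d i = m ∧ γ.val * M ∈ hermite (p : ℤ) d := by
  obtain ⟨γ, hγ, hlower, hpos, hupper⟩ := exists_isUnit_mul_hermite M (by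
    rw [← Int.natAbs_ne_zero, hM]; exact (pow_pos hp.pos _).ne')
  have hprod : (∏ i, (γ * M) i i).natAbs = p ^ m := by
    rw [← Matrix.det_of_isUpperTriangular fun i j hij => hlower i j hij, Matrix.det_mul,
      Int.natAbs_mul, natAbs_det_of_isUnit hγ, one_mul, hM]
  obtain ⟨s, d, hd, hsum⟩ := exists_eq_units_mul_pow_of_natAbs_prod_eq hp hprod
  have hdiag (i : Fin n) : (γ * M) i i = (p : ℤ) ^ d i := by
    rcases Int.units_eq_one_or (s i) with hs | hs
    · simpa [hs] using hd i
    · have := hpos i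
      have hpow : (0 : ℤ) < (p : ℤ) ^ d i := pow_pos (mod_cast hp.pos) _
      simp only [hd, hs, Units.val_neg, Units.val_one, neg_one_mul] at this
      omega
  refine ⟨hγ.unit, d, hsum, mem_hermite.2 ⟨hlower, hdiag, fun i j hij => ?_⟩⟩
  rw [← hdiag]
  exact hupper i j hij

theorem mul_eq_self_of_mem_hermite (hp : p ≠ 0)
    {γ M : Matrix (Fin n) (Fin n) ℤ} (hM : M ∈ hermite p d) (hγM : γ * M ∈ hermite p d) :
    γ * M = M := by
  obtain ⟨hlower, hdiag, hupper⟩ := mem_hermite.1 hM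
  obtain ⟨hlower', hdiag', hupper'⟩ := mem_hermite.1 hγM
  have hcol (j : Fin n) : ∀ i, (γ - 1) i j = 0 := by
    induction j using WellFoundedLT.induction with
    | ind j ih =>
    intro i
    have hentry : (γ * M) i j - M i j = (γ - 1) i j * p ^ d j := by
      rw [← Matrix.sub_apply, ← sub_one_mul, Matrix.mul_apply, Finset.sum_eq_single j, hdiag]
      · intro k _ hk
        rcases hk.lt_or_gt with hk | hk
        · rw [ih k hk, zero_mul]
        · rw [hlower k j hk, mul_zero]
      · simp
    have hequal : (γ * M) i j - M i j = 0 := by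
      rcases lt_trichotomy i j with hij | rfl | hij
      · refine Int.eq_zero_of_abs_lt_dvd (Dvd.intro_left _ hentry.symm) ?_
        have := hupper i j hij
        have := hupper' i j hij
        rw [abs_lt]
        omega
      · rw [hdiag, hdiag', sub_self]
      · rw [hlower i j hij, hlower' i j hij, sub_self]
    rw [hequal] at hentry
    exact (mul_eq_zero.1 hentry.symm).resolve_right (pow_ne_zero _ hp)
  have hγ : γ = 1 := sub_eq_zero.1 (Matrix.ext fun i j => hcol j i)
  rw [hγ, one_mul]

end HermiteNormalForm

section CountingHermite

open Finset

theorem pow_dvd_pow_mul_iff {α : Type*} [CommMonoidWithZero α] [IsLeftCancelMulZero α] {p : α}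
    (hp : p ≠ 0) {k d : ℕ} {c : α} : p ^ k ∣ p ^ d * c ↔ p ^ (k - d) ∣ c := by
  have : Nontrivial α := ⟨p, 0, hp⟩
  rcases le_total k d with h | h
  · simp [Nat.sub_eq_zero_of_le h, (pow_dvd_pow p h).mul_right c]
  · obtain ⟨j, rfl⟩ := Nat.exists_eq_add_of_le h
    rw [pow_add, Nat.add_sub_cancel_left, mul_dvd_mul_iff_left (pow_ne_zero d hp)]

open Classical in
theorem card_filter_of_iff_not_and_and_not {ι K : Type*} [Ring K] (s : Finset ι)
    {P Q R S : ι → Prop} (hRQ : ∀ i, R i → Q i) (hS : ∀ i, S i ↔ ¬P i ∧ Q i ∧ ¬R i) :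
    (#{i ∈ s | S i} : K) =
      #{i ∈ s | Q i} - #{i ∈ s | R i} - (#{i ∈ s | P i ∧ Q i} - #{i ∈ s | P i ∧ R i}) := by
  simp only [card_filter, Nat.cast_sum, ← sum_sub_distrib]
  refine sum_congr rfl fun i _ => ?_
  have := hRQ i
  have := hS i
  by_cases P i <;> by_cases Q i <;> by_cases R i <;> simp_all

variable {K : Type*} [Field K]

/-- The proportion of the matrices in `hermite p d` all of whose minors of order two are divisible
by `p ^ k`, as a function of `q = p`. In the notation of `entrywiseDvd_adjugate_upper_iff`, the
exponent `k - ∑ i, (k - d i)` is that of the divisibility of `x * y` by `p ^ min k d₁` that remains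
once the conditions on `x` and on `y` have been divided out. -/
def minorDensity (q : K) (k : ℕ) (d : Fin 3 → ℕ) : K :=
  if ∀ i j, i ≠ j → k ≤ d i + d j then
    ((k - ∑ i, (k - d i) + 1 : ℕ) - (k - ∑ i, (k - d i) : ℕ) / q) / q ^ max k (∑ i, (k - d i))
  else 0

theorem minorDensity_vec (q : K) (k d₀ d₁ d₂ : ℕ) :
    minorDensity q k ![d₀, d₁, d₂] =
      if k ≤ d₀ + d₁ ∧ k ≤ d₀ + d₂ ∧ k ≤ d₁ + d₂ then
        ((k - (k - d₀ + (k - d₁) + (k - d₂)) + 1 : ℕ) -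
          (k - (k - d₀ + (k - d₁) + (k - d₂)) : ℕ) / q) /
            q ^ max k (k - d₀ + (k - d₁) + (k - d₂))
      else 0 := by
  have hpairs : (∀ i j : Fin 3, i ≠ j → k ≤ ![d₀, d₁, d₂] i + ![d₀, d₁, d₂] j) ↔
      k ≤ d₀ + d₁ ∧ k ≤ d₀ + d₂ ∧ k ≤ d₁ + d₂ := by
    simp only [ne_eq, Fin.forall_fin_succ, Matrix.cons_val_zero, Matrix.cons_val_succ,
      Fin.succ_zero_eq_one, Matrix.cons_val_fin_one, Fin.succ_one_eq_two, IsEmpty.forall_iff,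
      and_true, not_true_eq_false, zero_ne_one, not_false_eq_true, forall_const, Fin.reduceEq,
      true_and, Fin.succ_ne_zero]
    omega
  simp only [minorDensity, hpairs, Fin.sum_univ_three, Matrix.cons_val]

/-- The proportion of the matrices of type `a` in `hermite p d`, as a function of `q = p`. The term
with `d - 1` removes the multiples `p • H`, whose adjugate is `p ^ 2 • H.adjugate`. -/
def typeDensity (q : K) (a : ℕ) (d : Fin 3 → ℕ) : K :=
  minorDensity q a d - minorDensity q (a + 1) d -
    if ∀ i, 1 ≤ d i then
      (minorDensity q (a - 2) (d - 1) - minorDensity q (a - 1) (d - 1)) / q ^ 3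
    else 0

theorem typeDensity_vec (q : K) (a d₀ d₁ d₂ : ℕ) :
    typeDensity q a ![d₀, d₁, d₂] =
      minorDensity q a ![d₀, d₁, d₂] - minorDensity q (a + 1) ![d₀, d₁, d₂] -
        if 1 ≤ d₀ ∧ 1 ≤ d₁ ∧ 1 ≤ d₂ then
          (minorDensity q (a - 2) ![d₀ - 1, d₁ - 1, d₂ - 1] -
            minorDensity q (a - 1) ![d₀ - 1, d₁ - 1, d₂ - 1]) / q ^ 3
        else 0 := by
  have hsub : ![d₀, d₁, d₂] - 1 = ![d₀ - 1, d₁ - 1, d₂ - 1] := by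
    ext i
    fin_cases i <;> rfl
  simp only [typeDensity, hsub, Fin.forall_fin_succ, Matrix.cons_val_zero, Matrix.cons_val_succ,
    IsEmpty.forall_iff, and_true]

variable {p : ℤ}

theorem card_filter_dvd_and_Ico_zero_mul {a : ℤ} (ha : 0 < a) (b : ℤ) (P : ℤ → Prop)
    [DecidablePred P] : #{x ∈ Ico 0 (a * b) | a ∣ x ∧ P x} = #{y ∈ Ico 0 b | P (a * y)} := by
  simp only [card_filter, ite_and, ← sum_filter, sum_filter_dvd_Ico_zero_mul ha]

theorem sum_filter_pow_dvd_card_filter [CharZero K] (hp : 0 < p) (hprime : Prime p)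
    {m n i j l : ℕ} (hi : i ≤ m) (hj : j ≤ n) (hm : l ≤ j + m) (hn : l ≤ i + n) :
    (∑ x ∈ Ico 0 (p ^ m) with p ^ i ∣ x, #{y ∈ Ico 0 (p ^ n) | p ^ j ∣ y ∧ p ^ l ∣ x * y} : K) =
      p ^ (m - i + (n - j)) * (((l - (i + j) + 1 : ℕ) - (l - (i + j) : ℕ) / (p : K)) /
        p ^ (l - (i + j))) := by
  obtain ⟨m, rfl⟩ := Nat.exists_eq_add_of_le hi
  obtain ⟨n, rfl⟩ := Nat.exists_eq_add_of_le hj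
  have hdvd (x y : ℤ) : p ^ l ∣ p ^ i * x * (p ^ j * y) ↔ p ^ (l - (i + j)) ∣ x * y := by
    rw [← pow_dvd_pow_mul_iff hp.ne', pow_add, mul_mul_mul_comm]
  simp only [pow_add p i, pow_add p j, sum_filter_dvd_Ico_zero_mul (pow_pos hp i),
    card_filter_dvd_and_Ico_zero_mul (pow_pos hp j), hdvd, Nat.add_sub_cancel_left]
  exact sum_card_filter_pow_dvd_mul hp hprime (by omega) (by omega)

theorem eq_upper_of_mem_hermite {d : Fin 3 → ℕ} {H : Matrix (Fin 3) (Fin 3) ℤ}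
    (hH : H ∈ hermite p d) :
    !![p ^ d 0, H 0 1, H 0 2; 0, p ^ d 1, H 1 2; 0, 0, p ^ d 2] = H := by
  obtain ⟨hlower, hdiag, -⟩ := mem_hermite.1 hH
  refine Eq.trans ?_ (Matrix.eta_fin_three H).symm
  rw [hdiag 0, hdiag 1, hdiag 2, hlower 1 0 (by decide), hlower 2 0 (by decide),
    hlower 2 1 (by decide)]

theorem sum_hermite_fin_three {M : Type*} [AddCommMonoid M] (d : Fin 3 → ℕ)
    (f : Matrix (Fin 3) (Fin 3) ℤ → M) :
    ∑ H ∈ hermite p d, f H =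
      ∑ x ∈ Ico 0 (p ^ d 1), ∑ y ∈ Ico 0 (p ^ d 2), ∑ z ∈ Ico 0 (p ^ d 2),
        f !![p ^ d 0, x, z; 0, p ^ d 1, y; 0, 0, p ^ d 2] := by
  simp only [← sum_product']
  refine sum_bij' (fun H _ => (H 0 1, H 1 2, H 0 2))
    (fun u _ => !![p ^ d 0, u.1, u.2.2; 0, p ^ d 1, u.2.1; 0, 0, p ^ d 2])
    (fun H hH => ?_) (fun u hu => ?_) (fun H hH => eq_upper_of_mem_hermite hH) (by simp)
    (fun H hH => congrArg f (eq_upper_of_mem_hermite hH).symm)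
  · obtain ⟨-, -, hupper⟩ := mem_hermite.1 hH
    simpa using ⟨hupper 0 1 (by decide), hupper 1 2 (by decide), hupper 0 2 (by decide)⟩
  · simp only [mem_product, mem_Ico] at hu
    simp [mem_hermite, Fin.forall_fin_succ, hu]

theorem entrywiseDvd_adjugate_upper_iff (hp : Prime p) {d₀ d₁ d₂ k : ℕ} {x y z : ℤ} :
    EntrywiseDvd (p ^ k) (!![p ^ d₀, x, z; 0, p ^ d₁, y; 0, 0, p ^ d₂]).adjugate ↔
      (k ≤ d₀ + d₁ ∧ k ≤ d₀ + d₂ ∧ k ≤ d₁ + d₂) ∧ p ^ (k - d₂) ∣ x ∧ p ^ (k - d₀) ∣ y ∧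
        p ^ k ∣ x * y - p ^ d₁ * z := by
  have hpow (i j : ℕ) : p ^ k ∣ p ^ i * p ^ j ↔ k ≤ i + j := by
    rw [← pow_add, pow_dvd_pow_iff hp.ne_zero hp.not_isUnit]
  rw [← hpow, ← hpow, ← hpow, ← pow_dvd_pow_mul_iff hp.ne_zero, ← pow_dvd_pow_mul_iff hp.ne_zero]
  simp only [EntrywiseDvd, Fin.forall_fin_succ, Matrix.adjugate_fin_three, Matrix.of_apply,
    Matrix.cons_val', Matrix.cons_val_one, Matrix.cons_val_zero, Matrix.cons_val_fin_one,
    Matrix.cons_val, mul_zero, sub_zero, add_zero, mul_comm, neg_zero, sub_self,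
    dvd_neg, Matrix.cons_val_succ, IsEmpty.forall_iff, and_true, dvd_zero, true_and]
  tauto

open Classical in
theorem card_filter_hermite_entrywiseDvd_adjugate_eq_sum (hp : 0 < p) (hprime : Prime p)
    {k d₀ d₁ d₂ : ℕ} (h₀₁ : k ≤ d₀ + d₁) (h₀₂ : k ≤ d₀ + d₂) (h₁₂ : k ≤ d₁ + d₂) :
    (#{H ∈ hermite p ![d₀, d₁, d₂] | EntrywiseDvd (p ^ k) H.adjugate} : ℤ) =
      (∑ x ∈ Ico 0 (p ^ d₁) with p ^ (k - d₂) ∣ x,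
        #{y ∈ Ico 0 (p ^ d₂) | p ^ (k - d₀) ∣ y ∧ p ^ min k d₁ ∣ x * y}) *
          p ^ (d₂ - (k - d₁)) := by
  have hz (c : ℤ) : ∑ z ∈ Ico 0 (p ^ d₂) with p ^ k ∣ c - p ^ d₁ * z, (1 : ℤ) =
      if p ^ min k d₁ ∣ c then p ^ (d₂ - (k - d₁)) else 0 := by
    rw [← card_filter_pow_dvd_sub_pow_mul hp h₁₂, card_eq_sum_ones, Nat.cast_sum, Nat.cast_one]
  rw [card_filter, sum_hermite_fin_three]
  simp only [Matrix.cons_val, entrywiseDvd_adjugate_upper_iff hprime, h₀₁, h₀₂, h₁₂, and_self,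
    true_and, ite_and, sum_ite_irrel, sum_const_zero, ← sum_filter, Nat.cast_sum, hz,
    card_eq_sum_ones, sum_mul, ← filter_filter, Nat.cast_one, one_mul]

open Classical in
theorem card_filter_hermite_entrywiseDvd_adjugate [CharZero K] (hp : 0 < p) (hprime : Prime p)
    (k : ℕ) (d : Fin 3 → ℕ) :
    (#{H ∈ hermite p d | EntrywiseDvd (p ^ k) H.adjugate} : K) =
      p ^ (d 1 + 2 * d 2) * minorDensity (p : K) k d := by
  have hpK : (p : K) ≠ 0 := by exact_mod_cast hp.ne'
  obtain ⟨d₀, d₁, d₂, rfl⟩ : ∃ d₀ d₁ d₂, d = ![d₀, d₁, d₂] :=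
    ⟨d 0, d 1, d 2, by ext i; fin_cases i <;> rfl⟩
  simp only [minorDensity_vec, Matrix.cons_val]
  split_ifs with hk
  · obtain ⟨h₀₁, h₀₂, h₁₂⟩ := hk
    have hcard := congrArg (Int.cast : ℤ → K)
      (card_filter_hermite_entrywiseDvd_adjugate_eq_sum hp hprime h₀₁ h₀₂ h₁₂)
    push_cast at hcard
    rw [hcard, sum_filter_pow_dvd_card_filter hp hprime (by omega) (by omega) (by omega)
      (by omega)]
    have hr : min k d₁ - (k - d₂ + (k - d₀)) = k - (k - d₀ + (k - d₁) + (k - d₂)) := by omega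
    rw [hr, div_eq_mul_inv _ (_ ^ max _ _)]
    have hexp : d₁ - (k - d₂) + (d₂ - (k - d₀)) + (d₂ - (k - d₁)) +
        max k (k - d₀ + (k - d₁) + (k - d₂)) =
        d₁ + 2 * d₂ + (k - (k - d₀ + (k - d₁) + (k - d₂))) := by omega
    field_simp
    linear_combination (norm := ring_nf)
      ((k - (k - d₀ + (k - d₁) + (k - d₂)) + 1 : ℕ) * (p : K) -
        (k - (k - d₀ + (k - d₁) + (k - d₂)) : ℕ)) * congrArg ((p : K) ^ ·) hexp
  · rw [mul_zero, Nat.cast_eq_zero, card_eq_zero, filter_eq_empty_iff]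
    intro H hH h
    rw [← eq_upper_of_mem_hermite hH] at h
    exact hk ((entrywiseDvd_adjugate_upper_iff hprime).1 h).1

end CountingHermite

section TypeCount

open Finset

theorem entrywiseDvd_smul_iff {n R : Type*} [CommRing R] {c : R} {M : Matrix n n R} :
    EntrywiseDvd c M ↔ ∃ N, M = c • N := by
  constructor
  · intro h
    choose N hN using h
    exact ⟨N, Matrix.ext hN⟩
  · rintro ⟨N, rfl⟩ i j
    exact dvd_mul_right c (N i j)

variable {p : ℤ} {n : ℕ}

theorem smul_mem_hermite_add_one_iff (hp : 0 < p) {d : Fin n → ℕ} {H : Matrix (Fin n) (Fin n) ℤ} :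
    p • H ∈ hermite p (d + 1) ↔ H ∈ hermite p d := by
  simp only [mem_hermite, Matrix.smul_apply, smul_eq_mul, Pi.add_apply, Pi.one_apply, pow_succ',
    mul_eq_zero, hp.ne', false_or, mul_right_inj' hp.ne', mul_lt_mul_iff_right₀ hp,
    mul_nonneg_iff_of_pos_left hp]

theorem entrywiseDvd_adjugate_smul_iff (hp : p ≠ 0) {k : ℕ} {H : Matrix (Fin n) (Fin n) ℤ} :
    EntrywiseDvd (p ^ k) (p • H).adjugate ↔ EntrywiseDvd (p ^ (k - (n - 1))) H.adjugate := by
  simp only [EntrywiseDvd, Matrix.adjugate_smul, Fintype.card_fin, Matrix.smul_apply, smul_eq_mul,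
    pow_dvd_pow_mul_iff hp]

theorem one_le_of_entrywiseDvd_of_mem_hermite (hp : Prime p) {d : Fin n → ℕ}
    {H : Matrix (Fin n) (Fin n) ℤ} (hH : H ∈ hermite p d) (h : EntrywiseDvd p H) (i : Fin n) :
    1 ≤ d i := by
  have hdiag := h i i
  rw [(mem_hermite.1 hH).2.1] at hdiag
  exact Nat.one_le_iff_ne_zero.2 fun h0 =>
    hp.not_isUnit (isUnit_of_dvd_one (by simpa [h0] using hdiag))

open Classical in
theorem card_filter_hermite_entrywiseDvd_and (hp : 0 < p) (hprime : Prime p) (k : ℕ)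
    (d : Fin n → ℕ) :
    #{H ∈ hermite p d | EntrywiseDvd p H ∧ EntrywiseDvd (p ^ k) H.adjugate} =
      if ∀ i, 1 ≤ d i then
        #{H ∈ hermite p (d - 1) | EntrywiseDvd (p ^ (k - (n - 1))) H.adjugate}
      else 0 := by
  split_ifs with hd
  · obtain ⟨e, rfl⟩ : ∃ e, d = e + 1 := ⟨d - 1, (tsub_add_cancel_of_le hd).symm⟩
    rw [add_tsub_cancel_right]
    symm
    refine card_bij (fun H _ => p • H) (fun H hH => ?_) (fun H _ H' _ h => ?_) fun H hH => ?_
    · rw [mem_filter] at hH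
      exact mem_filter.2 ⟨(smul_mem_hermite_add_one_iff hp).2 hH.1,
        entrywiseDvd_smul_iff.2 ⟨H, rfl⟩, (entrywiseDvd_adjugate_smul_iff hp.ne').2 hH.2⟩
    · exact smul_right_injective _ hp.ne' h
    · obtain ⟨hH, hdvd, hadj⟩ := mem_filter.1 hH
      obtain ⟨N, rfl⟩ := entrywiseDvd_smul_iff.1 hdvd
      exact ⟨N, mem_filter.2 ⟨(smul_mem_hermite_add_one_iff hp).1 hH,
        (entrywiseDvd_adjugate_smul_iff hp.ne').1 hadj⟩, rfl⟩
  · rw [card_eq_zero, filter_eq_empty_iff]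
    exact fun H hH h => hd (one_le_of_entrywiseDvd_of_mem_hermite hprime hH h.1)

open Classical in
theorem card_filter_hermite_hasType {K : Type*} [Field K] [CharZero K] (hp : 0 < p)
    (hprime : Prime p) (a : ℕ) (d : Fin 3 → ℕ) :
    (#{H ∈ hermite p d | HasType p a H} : K) =
      p ^ (d 1 + 2 * d 2) * typeDensity (p : K) a d := by
  have hpK : (p : K) ≠ 0 := by exact_mod_cast hp.ne'
  rw [card_filter_of_iff_not_and_and_not (S := HasType p a) _
      (fun H h i j => (pow_dvd_pow p a.le_succ).trans (h i j)) fun H => Iff.rfl,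
    card_filter_hermite_entrywiseDvd_adjugate hp hprime,
    card_filter_hermite_entrywiseDvd_adjugate hp hprime,
    card_filter_hermite_entrywiseDvd_and hp hprime, card_filter_hermite_entrywiseDvd_and hp hprime,
    typeDensity]
  split_ifs with hd
  · obtain ⟨e, rfl⟩ : ∃ e, d = e + 1 := ⟨d - 1, (tsub_add_cancel_of_le hd).symm⟩
    simp only [add_tsub_cancel_right, card_filter_hermite_entrywiseDvd_adjugate hp hprime,
      Nat.add_one_sub_one, Nat.reduceSubDiff, Pi.add_apply, Pi.one_apply]
    field_simp
    ring
  · simp [mul_sub]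

end TypeCount

section Cosets

variable {n p : ℕ}

theorem Lam_le_Gp (n p : ℕ) : Lam n ≤ Gp n p := by
  rintro _ ⟨γ, rfl⟩
  refine ⟨Matrix.GeneralLinearGroup.map (Int.castRingHom (zInv p)) γ, ?_⟩
  ext i j
  simp

theorem mem_cosets_mk {g : (Gp n p).toSubmonoid} {c : Coset n} :
    c ∈ cosets (HeckeCoset.mk (Lam n) (Lam n) g) ↔
      ∃ h ∈ Lam n, ∃ k ∈ Lam n, Coset.mk (h * g.1 * k) = c := by
  have hrel (g' : (Gp n p).toSubmonoid) :
      HeckeCoset.mk (Lam n) (Lam n) g' = HeckeCoset.mk (Lam n) (Lam n) g ↔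
        ∃ h ∈ Lam n, ∃ k ∈ Lam n, g'.1 = h * g.1 * k := by
    rw [eq_comm]
    exact (Quotient.eq (r := HeckeCoset.setoid (Gp n p).toSubmonoid (Lam n) (Lam n))).trans
      DoubleCoset.rel_iff
  constructor
  · rintro ⟨g', hg', rfl⟩
    obtain ⟨h, hh, k, hk, hg⟩ := (hrel g').1 hg'
    exact ⟨h, hh, k, hk, by rw [hg]⟩
  · rintro ⟨h, hh, k, hk, rfl⟩
    exact ⟨⟨h * g.1 * k, (Gp n p).mul_mem ((Gp n p).mul_mem (Lam_le_Gp n p hh) g.2)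
      (Lam_le_Gp n p hk)⟩, (hrel _).2 ⟨h, hh, k, hk, rfl⟩, rfl⟩

theorem ωCoset_eq (hp : p.Prime) {c : Coset n} {δ : Fin n → ℤ} (h : HasDiag p c δ) :
    ωCoset p c = ∏ i : Fin n, (x i / (p : RatFun n) ^ ((i : ℕ) + 1)) ^ δ i := by
  have hex : ∃ δ : Fin n → ℤ, HasDiag p c δ := ⟨δ, h⟩
  rw [ωCoset, dif_pos hex, hex.choose_spec.unique hp h]

theorem ω_t_eq_finsum [Fact p.Prime] (δ : Fin n → ℤ) :
    ω p (t p δ) = ∑ᶠ c ∈ cosets (HeckeCoset.mk (Lam n) (Lam n) (diagP p δ)), ωCoset p c := by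
  rw [ω, t, Equiv.symm_apply_apply, Finsupp.sum_single_index (by simp), Rat.cast_one, one_mul]

theorem Coset.mk_eq_mk_iff {g g' : GL (Fin n) ℚ} :
    Coset.mk g = Coset.mk g' ↔
      ∃ γ : GL (Fin n) ℤ, g'.val = γ.val.map (Int.castRingHom ℚ) * g.val := by
  rw [Quotient.eq, QuotientGroup.rightRel_apply]
  refine exists_congr fun γ => ?_
  rw [eq_mul_inv_iff_mul_eq, Units.ext_iff, Units.val_mul, eq_comm]
  rfl

/-- The coset of a nonsingular integral matrix; singular matrices get the junk value `Λ`. -/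
noncomputable def intCoset (M : Matrix (Fin n) (Fin n) ℤ) : Coset n :=
  if h : (M.map (Int.castRingHom ℚ)).det ≠ 0 then
    Coset.mk (Matrix.GeneralLinearGroup.mkOfDetNeZero _ h)
  else Coset.mk 1

variable {M N : Matrix (Fin n) (Fin n) ℤ}

theorem intCoset_eq_mk {g : GL (Fin n) ℚ} (hg : g.val = M.map (Int.castRingHom ℚ)) :
    intCoset M = Coset.mk g := by
  have hdet : (M.map (Int.castRingHom ℚ)).det ≠ 0 := by
    rw [← hg]
    exact ((Matrix.isUnit_iff_isUnit_det _).1 g.isUnit).ne_zero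
  rw [intCoset, dif_pos hdet]
  exact congrArg Coset.mk (Units.ext hg.symm)

theorem exists_val_eq_map (hM : M.det ≠ 0) :
    ∃ g : GL (Fin n) ℚ, g.val = M.map (Int.castRingHom ℚ) := by
  refine ⟨Matrix.GeneralLinearGroup.mkOfDetNeZero (M.map (Int.castRingHom ℚ)) ?_, rfl⟩
  rwa [← RingHom.mapMatrix_apply, ← RingHom.map_det, eq_intCast, Int.cast_ne_zero]

theorem intCoset_eq_intCoset_iff (hM : M.det ≠ 0) (hN : N.det ≠ 0) :
    intCoset M = intCoset N ↔ ∃ γ : GL (Fin n) ℤ, N = γ.val * M := by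
  obtain ⟨g, hg⟩ := exists_val_eq_map hM
  obtain ⟨h, hh⟩ := exists_val_eq_map hN
  rw [intCoset_eq_mk hg, intCoset_eq_mk hh, Coset.mk_eq_mk_iff]
  refine exists_congr fun γ => ?_
  rw [hg, hh, ← Matrix.map_mul, (Matrix.map_injective (Int.castRingHom ℚ).injective_int).eq_iff]

theorem hasDiag_intCoset (hp : p ≠ 0) {d : Fin n → ℕ} (hM : M ∈ hermite (p : ℤ) d) :
    HasDiag p (intCoset M) fun i => (d i : ℤ) := by
  obtain ⟨hlower, hdiag, -⟩ := mem_hermite.1 hM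
  obtain ⟨g, hg⟩ := exists_val_eq_map (M := M) (by
    rw [det_of_mem_hermite hM]
    exact pow_ne_zero _ (mod_cast hp))
  refine ⟨g, (intCoset_eq_mk hg).symm, fun i j hij => ?_, fun i => ?_⟩
  · simp [hg, hlower i j hij]
  · simp [hg, hdiag]

theorem mem_cosets_diagP_iff [Fact p.Prime] {e : Fin n → ℕ} {c : Coset n} :
    c ∈ cosets (HeckeCoset.mk (Lam n) (Lam n) (diagP p fun i => (e i : ℤ))) ↔
      ∃ M, UnimodularEquiv M (Matrix.diagonal fun i => (p : ℤ) ^ e i) ∧ intCoset M = c := by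
  have hdiag : (diagP p fun i => (e i : ℤ)).1.val =
      (Matrix.diagonal fun i => (p : ℤ) ^ e i).map (Int.castRingHom ℚ) := by
    ext i j
    by_cases h : i = j <;> simp [diagP, diagGL, pUnit, h]
  have hcoset (A B : GL (Fin n) ℤ) :
      intCoset (A.val * Matrix.diagonal (fun i => (p : ℤ) ^ e i) * B.val) =
        Coset.mk (Matrix.GeneralLinearGroup.map (Int.castRingHom ℚ) A *
          (diagP p fun i => (e i : ℤ)).1 * Matrix.GeneralLinearGroup.map (Int.castRingHom ℚ) B)
      := by
    refine intCoset_eq_mk ?_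
    rw [Units.val_mul, Units.val_mul, hdiag, Matrix.map_mul, Matrix.map_mul]
    rfl
  rw [mem_cosets_mk]
  constructor
  · rintro ⟨_, ⟨A, rfl⟩, _, ⟨B, rfl⟩, rfl⟩
    exact ⟨_, ⟨A, B, rfl⟩, hcoset A B⟩
  · rintro ⟨_, ⟨A, B, rfl⟩, rfl⟩
    exact ⟨_, ⟨A, rfl⟩, _, ⟨B, rfl⟩, (hcoset A B).symm⟩

open Classical in
/-- The Hermite normal forms in the double coset of `diag(p^{e_1}, …, p^{e_n})`, paired with the
exponents of `p` on their diagonals. -/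
noncomputable def hermiteReps (p : ℕ) (e : Fin n → ℕ) :
    Finset (Σ _ : Fin n → ℕ, Matrix (Fin n) (Fin n) ℤ) :=
  (Finset.Nat.antidiagonalTuple n (∑ i, e i)).sigma fun d =>
    {H ∈ hermite (p : ℤ) d | UnimodularEquiv H (Matrix.diagonal fun i => (p : ℤ) ^ e i)}

open Classical in
theorem mem_hermiteReps {e : Fin n → ℕ} {r : Σ _ : Fin n → ℕ, Matrix (Fin n) (Fin n) ℤ} :
    r ∈ hermiteReps p e ↔ ∑ i, r.1 i = ∑ i, e i ∧ r.2 ∈ hermite (p : ℤ) r.1 ∧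
      UnimodularEquiv r.2 (Matrix.diagonal fun i => (p : ℤ) ^ e i) := by
  rw [hermiteReps, Finset.mem_sigma, Finset.Nat.mem_antidiagonalTuple, Finset.mem_filter]

theorem injOn_intCoset_hermiteReps (hp : p.Prime) (e : Fin n → ℕ) :
    Set.InjOn (fun r => intCoset r.snd)
      (hermiteReps p e : Set (Σ _ : Fin n → ℕ, Matrix (Fin n) (Fin n) ℤ)) := by
  rintro ⟨d, H⟩ hr ⟨d', H'⟩ hr' (h : intCoset H = intCoset H')
  obtain ⟨-, hH, -⟩ := mem_hermiteReps.1 hr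
  obtain ⟨-, hH', -⟩ := mem_hermiteReps.1 hr'
  have hdiag := (hasDiag_intCoset hp.ne_zero hH).unique hp (h ▸ hasDiag_intCoset hp.ne_zero hH')
  obtain rfl : d = d' := funext fun i => mod_cast congrFun hdiag i
  have hp' : (p : ℤ) ≠ 0 := mod_cast hp.ne_zero
  have hdet {N} (hN : N ∈ hermite (p : ℤ) d) : N.det ≠ 0 := by
    rw [det_of_mem_hermite hN]
    exact pow_ne_zero _ hp'
  obtain ⟨γ, rfl⟩ := (intCoset_eq_intCoset_iff (hdet hH) (hdet hH')).1 h
  rw [mul_eq_self_of_mem_hermite hp' hH hH']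

theorem surjOn_intCoset_hermiteReps [hp : Fact p.Prime] (e : Fin n → ℕ) :
    Set.SurjOn (fun r => intCoset r.snd) (hermiteReps p e : Set (Σ _ : Fin n → ℕ, _))
      (cosets (HeckeCoset.mk (Lam n) (Lam n) (diagP p fun i => (e i : ℤ)))) := by
  intro c hc
  obtain ⟨M, hM, rfl⟩ := mem_cosets_diagP_iff.1 hc
  have hnatAbs : M.det.natAbs = p ^ ∑ i, e i := by
    rw [hM.natAbs_det, Matrix.det_diagonal, Finset.prod_pow_eq_pow_sum, Int.natAbs_pow,
      Int.natAbs_natCast]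
  have hdet : M.det ≠ 0 := by
    rw [← Int.natAbs_ne_zero, hnatAbs]
    exact pow_ne_zero _ hp.out.ne_zero
  obtain ⟨γ, d, hsum, hγM⟩ := exists_mul_mem_hermite hp.out M hnatAbs
  refine ⟨⟨d, γ.val * M⟩, mem_hermiteReps.2 ⟨hsum, hγM, hM.mul_left γ⟩, ?_⟩
  refine ((intCoset_eq_intCoset_iff hdet ?_).2 ⟨γ, rfl⟩).symm
  rw [det_of_mem_hermite hγM]
  exact pow_ne_zero _ (mod_cast hp.out.ne_zero)

theorem bijOn_intCoset_hermiteReps [hp : Fact p.Prime] (e : Fin n → ℕ) :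
    Set.BijOn (fun r => intCoset r.snd) (hermiteReps p e : Set (Σ _ : Fin n → ℕ, _))
      (cosets (HeckeCoset.mk (Lam n) (Lam n) (diagP p fun i => (e i : ℤ)))) :=
  ⟨fun r hr => mem_cosets_diagP_iff.2 ⟨r.2, (mem_hermiteReps.1 hr).2.2, rfl⟩,
    injOn_intCoset_hermiteReps hp.out e, surjOn_intCoset_hermiteReps e⟩

open Classical in
theorem ω_t_eq_sum [hp : Fact p.Prime] (e : Fin n → ℕ) :
    ω p (t p fun i => (e i : ℤ)) = ∑ d ∈ Finset.Nat.antidiagonalTuple n (∑ i, e i),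
      (Finset.card {H ∈ hermite (p : ℤ) d |
        UnimodularEquiv H (Matrix.diagonal fun i => (p : ℤ) ^ e i)} : RatFun n) *
          ∏ i, (x i / (p : RatFun n) ^ ((i : ℕ) + 1)) ^ d i := by
  rw [ω_t_eq_finsum, ← finsum_mem_eq_of_bijOn
    (f := fun r => ∏ i, (x i / (p : RatFun n) ^ ((i : ℕ) + 1)) ^ r.1 i) _
    (bijOn_intCoset_hermiteReps e), finsum_mem_coe_finset, hermiteReps, Finset.sum_sigma]
  · simp only [Finset.sum_const, nsmul_eq_mul]
  · intro r hr
    rw [ωCoset_eq hp.out (hasDiag_intCoset hp.out.ne_zero (mem_hermiteReps.1 hr).2.1)]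
    simp only [zpow_natCast]

end Cosets

section Symmetrization

open Finset

theorem sum_antidiagonalTuple_eq_sum_antitone {M : Type*} [AddCommMonoid M] (n N : ℕ)
    (f : (Fin n → ℕ) → M) :
    ∑ d ∈ Nat.antidiagonalTuple n N, f d =
      ∑ e ∈ Nat.antidiagonalTuple n N with Antitone e,
        ∑ d ∈ univ.image fun (σ : Equiv.Perm (Fin n)) l => e (σ l), f d := by
  let sorted (d : Fin n → ℕ) : Fin n → ℕ := d ∘ (Fin.revPerm.trans (Tuple.sort d))
  have antitone_sorted (d : Fin n → ℕ) : Antitone (sorted d) :=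
    (Tuple.monotone_sort d).comp_antitone Fin.rev_anti
  have sorted_mem {d : Fin n → ℕ} (hd : d ∈ Nat.antidiagonalTuple n N) :
      sorted d ∈ {e ∈ Nat.antidiagonalTuple n N | Antitone e} := by
    rw [mem_filter, Nat.mem_antidiagonalTuple, ← Nat.mem_antidiagonalTuple.1 hd]
    exact ⟨Equiv.sum_comp _ d, antitone_sorted d⟩
  rw [← sum_fiberwise_of_maps_to fun d hd => sorted_mem hd]
  refine sum_congr rfl fun e he => sum_congr ?_ fun _ _ => rfl
  obtain ⟨hsum, he⟩ := mem_filter.1 he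
  rw [Nat.mem_antidiagonalTuple] at hsum
  ext d
  simp only [mem_filter, Nat.mem_antidiagonalTuple, mem_image, mem_univ, true_and]
  constructor
  · rintro ⟨-, rfl⟩
    exact ⟨(Fin.revPerm.trans (Tuple.sort d)).symm, by ext; simp [sorted]⟩
  · rintro ⟨σ, rfl⟩
    refine ⟨(Equiv.sum_comp σ e).trans hsum, ?_⟩
    exact Tuple.unique_antitone (f := e)
      (σ := (Fin.revPerm.trans (Tuple.sort (e ∘ σ))).trans σ) (τ := 1)
      (antitone_sorted (e ∘ σ)) he

theorem sum_antitone_antidiagonalTuple_three {M : Type*} [AddCommMonoid M] (N : ℕ)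
    (f : (Fin 3 → ℕ) → M) :
    ∑ e ∈ Nat.antidiagonalTuple 3 N with Antitone e, f e =
      ∑ k ∈ range (N / 3 + 1), ∑ j ∈ range ((N - 3 * k) / 2 + 1),
        f ![N - 2 * k - j, k + j, k] := by
  have mem_iff (e : Fin 3 → ℕ) : e ∈ {e ∈ Nat.antidiagonalTuple 3 N | Antitone e} ↔
      e 0 + e 1 + e 2 = N ∧ e 1 ≤ e 0 ∧ e 2 ≤ e 1 := by
    simp [Nat.mem_antidiagonalTuple, Fin.sum_univ_three, Fin.antitone_iff_succ_le,
      Fin.forall_fin_two]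
  have eq_vec {e : Fin 3 → ℕ} (he : e 0 + e 1 + e 2 = N ∧ e 1 ≤ e 0 ∧ e 2 ≤ e 1) :
      ![N - 2 * e 2 - (e 1 - e 2), e 2 + (e 1 - e 2), e 2] = e := by
    ext i
    fin_cases i <;> simp <;> omega
  rw [sum_sigma']
  refine sum_bij' (fun e _ => ⟨e 2, e 1 - e 2⟩)
    (fun u _ => ![N - 2 * u.1 - u.2, u.1 + u.2, u.1]) (fun e he => ?_) (fun u hu => ?_)
    (fun e he => eq_vec ((mem_iff e).1 he)) (fun u _ => by simp)
    (fun e he => congrArg f (eq_vec ((mem_iff e).1 he)).symm)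
  · have := (mem_iff e).1 he
    simp only [mem_sigma, mem_range]
    omega
  · simp only [mem_sigma, mem_range] at hu
    rw [mem_iff]
    simp only [Matrix.cons_val]
    omega

theorem sum_antidiagonalTuple_mul_prod_eq_sum_sym (N : ℕ) {c : (Fin 3 → ℕ) → RatFun 3}
    (hc : ∀ (σ : Equiv.Perm (Fin 3)) d, c (d ∘ σ) = c d) :
    ∑ d ∈ Nat.antidiagonalTuple 3 N, c d * ∏ l, x l ^ d l =
      ∑ k ∈ range (N / 3 + 1), ∑ j ∈ range ((N - 3 * k) / 2 + 1),
        c ![N - 2 * k - j, k + j, k] * sym (N - 2 * k - j) (k + j) k := by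
  have sum_orbit (e : Fin 3 → ℕ) :
      ∑ d ∈ univ.image fun (σ : Equiv.Perm (Fin 3)) l => e (σ l), c d * ∏ l, x l ^ d l =
        c e * ∑ d ∈ univ.image fun (σ : Equiv.Perm (Fin 3)) l => e (σ l), ∏ l, x l ^ d l := by
    rw [mul_sum]
    refine sum_congr rfl fun d hd => ?_
    obtain ⟨σ, -, rfl⟩ := mem_image.1 hd
    exact congrArg (· * _) (hc σ e)
  simp only [sum_antidiagonalTuple_eq_sum_antitone, sum_orbit,
    sum_antitone_antidiagonalTuple_three]
  rfl

theorem minorDensity_comp_perm {K : Type*} [Field K] (q : K) (k : ℕ) (σ : Equiv.Perm (Fin 3))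
    (d : Fin 3 → ℕ) : minorDensity q k (d ∘ σ) = minorDensity q k d := by
  have hsum : ∑ i, (k - (d ∘ σ) i) = ∑ i, (k - d i) := Equiv.sum_comp σ fun i => k - d i
  have hpairs : (∀ i j, i ≠ j → k ≤ (d ∘ σ) i + (d ∘ σ) j) ↔ ∀ i j, i ≠ j → k ≤ d i + d j :=
    σ.forall_congr fun i => σ.forall_congr fun j => by rw [σ.injective.ne_iff]; rfl
  simp only [minorDensity, hsum, hpairs]

theorem typeDensity_comp_perm {K : Type*} [Field K] (q : K) (a : ℕ) (σ : Equiv.Perm (Fin 3))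
    (d : Fin 3 → ℕ) : typeDensity q a (d ∘ σ) = typeDensity q a d := by
  have hone : (∀ i, 1 ≤ (d ∘ σ) i) ↔ ∀ i, 1 ≤ d i := σ.forall_congr fun i => Iff.rfl
  have hsub : d ∘ σ - 1 = (d - 1) ∘ σ := rfl
  simp only [typeDensity, hone, hsub, minorDensity_comp_perm]

theorem sym_zero : sym 0 0 0 = 1 := by
  have hzero : (![0, 0, 0] : Fin 3 → ℕ) = 0 := by decide
  have himage : (univ.image fun (σ : Equiv.Perm (Fin 3)) l => (![0, 0, 0] : Fin 3 → ℕ) (σ l)) =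
      {0} := by
    rw [hzero]
    exact image_const univ_nonempty 0
  rw [sym, himage, sum_singleton]
  exact prod_eq_one fun i _ => pow_zero (x i)

instance (n : ℕ) : CharZero (RatFun n) :=
  charZero_of_injective_algebraMap (IsFractionRing.injective (MvPolynomial (Fin n) ℚ) (RatFun n))

theorem pow_mul_prod_div_pow {q : RatFun 3} (hq : q ≠ 0) (d : Fin 3 → ℕ) :
    q ^ (d 1 + 2 * d 2) * ∏ i, (x i / q ^ ((i : ℕ) + 1)) ^ d i =
      (∏ i, x i ^ d i) / q ^ ∑ i, d i := by
  simp only [Fin.sum_univ_three, Fin.prod_univ_three, div_pow, ← pow_mul, Fin.val_zero,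
    Fin.val_one, Fin.val_two]
  field_simp
  ring

theorem ω_t_eq_sum_sym (p : ℕ) [hp : Fact p.Prime] {a b : ℕ} (hab : a ≤ b) :
    ω p (t p ![0, (a : ℤ), (b : ℤ)]) =
      (∑ k ∈ range ((a + b) / 3 + 1), ∑ j ∈ range ((a + b - 3 * k) / 2 + 1),
        typeDensity (p : RatFun 3) a ![a + b - 2 * k - j, k + j, k] *
          sym (a + b - 2 * k - j) (k + j) k) / (p : RatFun 3) ^ (a + b) := by
  have hp₀ : (p : RatFun 3) ≠ 0 := Nat.cast_ne_zero.2 hp.out.ne_zero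
  have hexp : ![0, (a : ℤ), (b : ℤ)] = fun i => ((![0, a, b] : Fin 3 → ℕ) i : ℤ) := by
    ext i
    fin_cases i <;> rfl
  have hsum : ∑ i, (![0, a, b] : Fin 3 → ℕ) i = a + b := by simp [Fin.sum_univ_three]
  rw [hexp, ω_t_eq_sum, hsum, ← sum_antidiagonalTuple_mul_prod_eq_sum_sym (a + b)
    fun σ d => typeDensity_comp_perm (p : RatFun 3) a σ d, sum_div]
  refine sum_congr rfl fun d hd => ?_
  rw [Nat.mem_antidiagonalTuple] at hd
  classical
  have hcard : (#{H ∈ hermite (p : ℤ) d | UnimodularEquiv H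
      (Matrix.diagonal fun i => (p : ℤ) ^ (![0, a, b] : Fin 3 → ℕ) i)} : RatFun 3) =
      p ^ (d 1 + 2 * d 2) * typeDensity (p : RatFun 3) a d := by
    have hcount := card_filter_hermite_hasType (K := RatFun 3) (mod_cast hp.out.pos)
      (Nat.prime_iff_prime_int.1 hp.out) a d
    rw [Int.cast_natCast] at hcount
    rw [← hcount]
    congr 2
    refine filter_congr fun H hH => (hasType_iff hp.out hab ?_).symm
    rw [det_of_mem_hermite hH, hd, Int.natAbs_pow, Int.natAbs_natCast]
  rw [hcard, mul_assoc, mul_left_comm, pow_mul_prod_div_pow hp₀, hd, mul_div_assoc]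

end Symmetrization

end GLHecke

set_option maxHeartbeats 600000 in
-- The limit covers the expansion of all 28 formulas.
theorem mainTheorem3 (p : ℕ) [Fact p.Prime] :
    (ω p (t p ![0, 0, 0]) = 1 :) ∧
    (ω p (t p ![0, 0, 1]) =
      sym 1 0 0 / p :) ∧
    (ω p (t p ![0, 1, 1]) =
      sym 1 1 0 / p ^ 3 :) ∧
    (ω p (t p ![0, 0, 2]) =
      (p - 1) * sym 1 1 0 / p ^ 3 + sym 2 0 0 / p ^ 2 :) ∧
    (ω p (t p ![0, 1, 2]) =
      (2 * p ^ 2 - p - 1) * sym 1 1 1 / p ^ 6 + sym 2 1 0 / p ^ 4 :) ∧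
    (ω p (t p ![0, 2, 2]) =
      (p - 1) * sym 2 1 1 / p ^ 7 + sym 2 2 0 / p ^ 6 :) ∧
    (ω p (t p ![0, 0, 3]) =
      (p ^ 2 - 2 * p + 1) * sym 1 1 1 / p ^ 5 + (p ^ 2 - p) * sym 2 1 0 / p ^ 5
      + sym 3 0 0 / p ^ 3 :) ∧
    (ω p (t p ![0, 1, 3]) =
      (2 * p - 2) * sym 2 1 1 / p ^ 6 + (p - 1) * sym 2 2 0 / p ^ 6 + sym 3 1 0 / p ^ 5 :) ∧
    (ω p (t p ![0, 2, 3]) =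
      (2 * p - 2) * sym 2 2 1 / p ^ 8 + (p - 1) * sym 3 1 1 / p ^ 8 + sym 3 2 0 / p ^ 7 :) ∧
    (ω p (t p ![0, 3, 3]) =
      (p ^ 2 - 2 * p + 1) * sym 2 2 2 / p ^ 11 + (p ^ 2 - p) * sym 3 2 1 / p ^ 11
      + sym 3 3 0 / p ^ 9 :) ∧
    (ω p (t p ![0, 0, 4]) =
      (p ^ 2 - 2 * p + 1) * sym 2 1 1 / p ^ 6 + (p ^ 2 - p) * sym 2 2 0 / p ^ 6
      + (p ^ 2 - p) * sym 3 1 0 / p ^ 6 + sym 4 0 0 / p ^ 4 :) ∧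
    (ω p (t p ![0, 1, 4]) =
      (2 * p ^ 2 - 3 * p + 1) * sym 2 2 1 / p ^ 8 + (2 * p ^ 2 - 2 * p) * sym 3 1 1 / p ^ 8
      + (p ^ 2 - p) * sym 3 2 0 / p ^ 8 + sym 4 1 0 / p ^ 6 :) ∧
    (ω p (t p ![0, 2, 4]) =
      (3 * p ^ 3 - 4 * p ^ 2 + 2 * p - 1) * sym 2 2 2 / p ^ 11
      + (2 * p ^ 3 - 3 * p ^ 2 + p) * sym 3 2 1 / p ^ 11
      + (p ^ 3 - p ^ 2) * sym 3 3 0 / p ^ 11 + (p ^ 3 - p ^ 2) * sym 4 1 1 / p ^ 11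
      + sym 4 2 0 / p ^ 8 :) ∧
    (ω p (t p ![0, 3, 4]) =
      (2 * p ^ 2 - 3 * p + 1) * sym 3 2 2 / p ^ 12
      + (2 * p ^ 2 - 2 * p) * sym 3 3 1 / p ^ 12 + (p ^ 2 - p) * sym 4 2 1 / p ^ 12
      + sym 4 3 0 / p ^ 10 :) ∧
    (ω p (t p ![0, 4, 4]) =
      (p ^ 2 - 2 * p + 1) * sym 3 3 2 / p ^ 14 + (p ^ 2 - p) * sym 4 2 2 / p ^ 14
      + (p ^ 2 - p) * sym 4 3 1 / p ^ 14 + sym 4 4 0 / p ^ 12 :) ∧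
    (ω p (t p ![0, 0, 5]) =
      (p ^ 2 - 2 * p + 1) * sym 2 2 1 / p ^ 7 + (p ^ 2 - 2 * p + 1) * sym 3 1 1 / p ^ 7
      + (p ^ 2 - p) * sym 3 2 0 / p ^ 7 + (p ^ 2 - p) * sym 4 1 0 / p ^ 7
      + sym 5 0 0 / p ^ 5 :) ∧
    (ω p (t p ![0, 1, 5]) =
      (2 * p ^ 2 - 4 * p + 2) * sym 2 2 2 / p ^ 9
      + (2 * p ^ 2 - 3 * p + 1) * sym 3 2 1 / p ^ 9 + (p ^ 2 - p) * sym 3 3 0 / p ^ 9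
      + (2 * p ^ 2 - 2 * p) * sym 4 1 1 / p ^ 9 + (p ^ 2 - p) * sym 4 2 0 / p ^ 9
      + sym 5 1 0 / p ^ 7 :) ∧
    (ω p (t p ![0, 2, 5]) =
      (3 * p ^ 3 - 5 * p ^ 2 + 3 * p - 1) * sym 3 2 2 / p ^ 12
      + (2 * p ^ 3 - 4 * p ^ 2 + 2 * p) * sym 3 3 1 / p ^ 12
      + (2 * p ^ 3 - 3 * p ^ 2 + p) * sym 4 2 1 / p ^ 12
      + (p ^ 3 - p ^ 2) * sym 4 3 0 / p ^ 12 + (p ^ 3 - p ^ 2) * sym 5 1 1 / p ^ 12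
      + sym 5 2 0 / p ^ 9 :) ∧
    (ω p (t p ![0, 3, 5]) =
      (3 * p ^ 3 - 5 * p ^ 2 + 3 * p - 1) * sym 3 3 2 / p ^ 14
      + (2 * p ^ 3 - 4 * p ^ 2 + 2 * p) * sym 4 2 2 / p ^ 14
      + (2 * p ^ 3 - 3 * p ^ 2 + p) * sym 4 3 1 / p ^ 14
      + (p ^ 3 - p ^ 2) * sym 4 4 0 / p ^ 14 + (p ^ 3 - p ^ 2) * sym 5 2 1 / p ^ 14
      + sym 5 3 0 / p ^ 11 :) ∧
    (ω p (t p ![0, 4, 5]) =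
      (2 * p ^ 2 - 4 * p + 2) * sym 3 3 3 / p ^ 15
      + (2 * p ^ 2 - 3 * p + 1) * sym 4 3 2 / p ^ 15
      + (2 * p ^ 2 - 2 * p) * sym 4 4 1 / p ^ 15 + (p ^ 2 - p) * sym 5 2 2 / p ^ 15
      + (p ^ 2 - p) * sym 5 3 1 / p ^ 15 + sym 5 4 0 / p ^ 13 :) ∧
    (ω p (t p ![0, 5, 5]) =
      (p ^ 2 - 2 * p + 1) * sym 4 3 3 / p ^ 17 + (p ^ 2 - 2 * p + 1) * sym 4 4 2 / p ^ 17
      + (p ^ 2 - p) * sym 5 3 2 / p ^ 17 + (p ^ 2 - p) * sym 5 4 1 / p ^ 17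
      + sym 5 5 0 / p ^ 15 :) ∧
    (ω p (t p ![0, 0, 6]) =
      (p ^ 2 - 2 * p + 1) * sym 2 2 2 / p ^ 8 + (p ^ 2 - 2 * p + 1) * sym 3 2 1 / p ^ 8
      + (p ^ 2 - p) * sym 3 3 0 / p ^ 8 + (p ^ 2 - 2 * p + 1) * sym 4 1 1 / p ^ 8
      + (p ^ 2 - p) * sym 4 2 0 / p ^ 8 + (p ^ 2 - p) * sym 5 1 0 / p ^ 8
      + sym 6 0 0 / p ^ 6 :) ∧
    (ω p (t p ![0, 1, 6]) =
      (2 * p ^ 2 - 4 * p + 2) * sym 3 2 2 / p ^ 10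
      + (2 * p ^ 2 - 3 * p + 1) * sym 3 3 1 / p ^ 10
      + (2 * p ^ 2 - 3 * p + 1) * sym 4 2 1 / p ^ 10 + (p ^ 2 - p) * sym 4 3 0 / p ^ 10
      + (2 * p ^ 2 - 2 * p) * sym 5 1 1 / p ^ 10 + (p ^ 2 - p) * sym 5 2 0 / p ^ 10
      + sym 6 1 0 / p ^ 8 :) ∧
    (ω p (t p ![0, 2, 6]) =
      (3 * p ^ 3 - 6 * p ^ 2 + 4 * p - 1) * sym 3 3 2 / p ^ 13
      + (3 * p ^ 3 - 5 * p ^ 2 + 3 * p - 1) * sym 4 2 2 / p ^ 13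
      + (2 * p ^ 3 - 4 * p ^ 2 + 2 * p) * sym 4 3 1 / p ^ 13
      + (p ^ 3 - p ^ 2) * sym 4 4 0 / p ^ 13
      + (2 * p ^ 3 - 3 * p ^ 2 + p) * sym 5 2 1 / p ^ 13
      + (p ^ 3 - p ^ 2) * sym 5 3 0 / p ^ 13 + (p ^ 3 - p ^ 2) * sym 6 1 1 / p ^ 13
      + sym 6 2 0 / p ^ 10 :) ∧
    (ω p (t p ![0, 3, 6]) =
      (4 * p ^ 3 - 7 * p ^ 2 + 5 * p - 2) * sym 3 3 3 / p ^ 15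
      + (3 * p ^ 3 - 6 * p ^ 2 + 4 * p - 1) * sym 4 3 2 / p ^ 15
      + (2 * p ^ 3 - 4 * p ^ 2 + 2 * p) * sym 4 4 1 / p ^ 15
      + (2 * p ^ 3 - 4 * p ^ 2 + 2 * p) * sym 5 2 2 / p ^ 15
      + (2 * p ^ 3 - 3 * p ^ 2 + p) * sym 5 3 1 / p ^ 15
      + (p ^ 3 - p ^ 2) * sym 5 4 0 / p ^ 15 + (p ^ 3 - p ^ 2) * sym 6 2 1 / p ^ 15
      + sym 6 3 0 / p ^ 12 :) ∧
    (ω p (t p ![0, 4, 6]) =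
      (3 * p ^ 3 - 6 * p ^ 2 + 4 * p - 1) * sym 4 3 3 / p ^ 17
      + (3 * p ^ 3 - 5 * p ^ 2 + 3 * p - 1) * sym 4 4 2 / p ^ 17
      + (2 * p ^ 3 - 4 * p ^ 2 + 2 * p) * sym 5 3 2 / p ^ 17
      + (2 * p ^ 3 - 3 * p ^ 2 + p) * sym 5 4 1 / p ^ 17
      + (p ^ 3 - p ^ 2) * sym 5 5 0 / p ^ 17 + (p ^ 3 - p ^ 2) * sym 6 2 2 / p ^ 17
      + (p ^ 3 - p ^ 2) * sym 6 3 1 / p ^ 17 + sym 6 4 0 / p ^ 14 :) ∧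
    (ω p (t p ![0, 5, 6]) =
      (2 * p ^ 2 - 4 * p + 2) * sym 4 4 3 / p ^ 18
      + (2 * p ^ 2 - 3 * p + 1) * sym 5 3 3 / p ^ 18
      + (2 * p ^ 2 - 3 * p + 1) * sym 5 4 2 / p ^ 18
      + (2 * p ^ 2 - 2 * p) * sym 5 5 1 / p ^ 18 + (p ^ 2 - p) * sym 6 3 2 / p ^ 18
      + (p ^ 2 - p) * sym 6 4 1 / p ^ 18 + sym 6 5 0 / p ^ 16 :) ∧
    (ω p (t p ![0, 6, 6]) =
      (p ^ 2 - 2 * p + 1) * sym 4 4 4 / p ^ 20 + (p ^ 2 - 2 * p + 1) * sym 5 4 3 / p ^ 20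
      + (p ^ 2 - 2 * p + 1) * sym 5 5 2 / p ^ 20 + (p ^ 2 - p) * sym 6 3 3 / p ^ 20
      + (p ^ 2 - p) * sym 6 4 2 / p ^ 20 + (p ^ 2 - p) * sym 6 5 1 / p ^ 20
      + sym 6 6 0 / p ^ 18 :) := by
  have row (a b : ℕ) (hab : a ≤ b := by decide) := ω_t_eq_sum_sym p hab
  have hp : (p : RatFun 3) ≠ 0 := Nat.cast_ne_zero.mpr (Fact.out : p.Prime).ne_zero
  refine ⟨(row 0 0).trans ?_, (row 0 1).trans ?_, (row 1 1).trans ?_, (row 0 2).trans ?_,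
    (row 1 2).trans ?_, (row 2 2).trans ?_, (row 0 3).trans ?_, (row 1 3).trans ?_,
    (row 2 3).trans ?_, (row 3 3).trans ?_, (row 0 4).trans ?_, (row 1 4).trans ?_,
    (row 2 4).trans ?_, (row 3 4).trans ?_, (row 4 4).trans ?_, (row 0 5).trans ?_,
    (row 1 5).trans ?_, (row 2 5).trans ?_, (row 3 5).trans ?_, (row 4 5).trans ?_,
    (row 5 5).trans ?_, (row 0 6).trans ?_, (row 1 6).trans ?_, (row 2 6).trans ?_,
    (row 3 6).trans ?_, (row 4 6).trans ?_, (row 5 6).trans ?_, (row 6 6).trans ?_⟩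
  all_goals
    simp only [Finset.sum_range_succ, Finset.sum_range_zero, Nat.reduceAdd, Nat.reduceSub,
      Nat.reduceMul, Nat.reduceDiv, Nat.reduceLeDiff, typeDensity_vec, minorDensity_vec,
      Nat.max_def, and_true, and_self, and_false, if_true, if_false, Nat.cast_zero, Nat.cast_one,
      Nat.cast_ofNat, zero_div, sub_zero, zero_mul, zero_add, sym_zero]
    field_simp
  all_goals ring
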